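/- Let $X\subseteq\mathbb{R}^n$ be closed and convex, let $N\ge 1$, and let $f_1,\dots,f_N:\mathbb{R}^n\to\mathbb{R}$ be $\rho$-weakly convex with $\rho\ge 0$ (that is, $f_i+\frac{\rho}{2}\|\cdot\|^2$ is convex) and $L$-Lipschitz on $X$. Assume that $f=\frac1N\sum_{i=1}^N f_i$ is bounded below on $X$. For $t>0$ with $2\rho t<1$ let $$\varphi_t(x)=\inf_{y\in X}\Big\{f(y)+\tfrac{1}{2t}\|y-x\|^2\Big\}$$ be the Moreau envelope. *Network.* Let $A(k)=[a_{ij}(k)]$, $k\ge 0$, be doubly stochastic $N\times N$ matrices such that, for some $\eta\in(0,1)$ and some integer $B\ge 1$: $a_{ii}(k)\ge\eta$; each $a_{ij}(k)$ is either $0$ or at least $\eta$; the directed graph $E_\infty$ of all pairs $(j,i)$ with $a_{ij}(k)>0$ for infinitely many $k$ is strongly connected; and for each $(j,i)\in E_\infty$, among any $B$ consecutive times there is one, $l$, with $a_{ij}(l)>0$. Write $\Phi(k,s)=A(k)A(k-1)\cdots A(s)$ for $k\ge s$. *Algorithm.* For step sizes $\alpha_k>0$ and initial points $x_{i,0}\in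 X$ (deterministic, or random and square-integrable), the stochastic distributed projected subgradient method is $$v_{i,k}=\sum_{j=1}^N a_{ij}(k)x_{j,k},\qquad x_{i,k+1}=\mathrm{Proj}_X\big(v_{i,k}-\alpha_k\xi_{i,k}\big),\qquad \bar x_k=\frac1N\sum_{i=1}^N x_{i,k}.$$ Here $(\mathcal F_k)$ is a filtration, $x_{i,0}$ is $\mathcal F_0$-measurable, $\xi_{i,k}$ is $\mathcal F_{k+1}$-measurable and square-integrable, $\mathbb{E}[\xi_{i,k}\mid\mathcal F_k]\in\partial f_i(v_{i,k})$ almost surely ($\partial$ is the Fréchet subdifferential), and $\mathbb{E}\|\xi_{i,k}\|^2\le L^2$. Let $\bar\varphi_{t,0}=\frac1N\sum_{i=1}^N\varphi_t(x_{i,0})$. Then the following hold. (0) There are $c>0$ and $\lambda\in(0,1)$, depending only on $N,\eta,B$, such that $\big\|\Phi(k,s)-\frac1N\mathbf 1\mathbf 1^\top\big\|_{\mathrm{op}}\le c\lambda^{k-s}$ for all $k\ge s\ge 0$ and all such networks. (1) $\varphi_t$ is differentiable on $\mathbb{R}^n$, and $\varphi_t(x_{i,k})$, $\varphi_t(\bar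 x_k)$ and $\|\nabla\varphi_t(\bar x_k)\|^2$ are integrable for all $i,k$. If moreover $\sum_k\alpha_k=\infty$, $\sum_k\alpha_k^2<\infty$ and $\lim_{k\to\infty}\alpha_{k+1}/\alpha_k=1$, then there is a real number $\bar\varphi_t$ such that $\mathbb{E}\,\varphi_t(\bar x_k)\to\bar\varphi_t$ and $\mathbb{E}\,\varphi_t(x_{i,k})\to\bar\varphi_t$ for every $i$, and $\liminf_{k\to\infty}\mathbb{E}\|\nabla\varphi_t(\bar x_k)\|^2=0$. (2) Suppose $\frac{c_1}{\sqrt{k+1}}\le\alpha_k\le\frac{c_2}{\sqrt{k+1}}$ for all $k\ge 0$, where $c_1>0$. For all $c>0$ and $\lambda\in(0,1)$ for which the bound in (0) holds for the given network, there is a constant $C>0$ depending only on $\rho,t,c_1,c_2,c$ such that, for all sufficiently large $T$, $$\min_{1\le k\le T}\mathbb{E}\|\nabla\varphi_t(\bar x_k)\|^2\le C\left(\frac{\mathbb{E}\,\bar\varphi_{t,0}-\inf_X f}{\sqrt T}+\frac{L^2}{(1-\lambda)^2}\cdot\frac{\log T}{\sqrt T}\right).$$ -/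

import Mathlib

open Set Filter Topology MeasureTheory ProbabilityTheory
open scoped NNReal ENNReal

universe u

noncomputable section

namespace StoDPSM

/-- Euclidean space `ℝⁿ`. -/
abbrev Vec (n : ℕ) : Type := EuclideanSpace ℝ (Fin n)

/-- `f : ℝⁿ → ℝ` is `ρ`-weakly convex: `f + (ρ/2)‖·‖²` is convex. -/
def WeaklyConvex {n : ℕ} (ρ : ℝ) (f : Vec n → ℝ) : Prop :=
  ConvexOn ℝ univ (fun x => f x + ρ / 2 * ‖x‖ ^ 2)

/-- The (Fréchet) subdifferential of `f` at `x`: all `g` with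
`f y ≥ f x + ⟪g, y - x⟫ + o(‖y - x‖)` as `y → x`. -/
def subdifferential {n : ℕ} (f : Vec n → ℝ) (x : Vec n) : Set (Vec n) :=
  {g | ∀ ε > 0, ∀ᶠ y in 𝓝 x, f x + inner ℝ g (y - x) - ε * ‖y - x‖ ≤ f y}

/-- The global objective `f = (1/N) ∑ᵢ fᵢ`. -/
def objective {n N : ℕ} (f : Fin N → Vec n → ℝ) (x : Vec n) : ℝ :=
  (∑ i, f i x) / N

/-- The Moreau envelope of `h` over the constraint set `X`:
`φₜ(x) = inf_{y ∈ X} h(y) + ‖y - x‖² / (2t)`. -/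
def moreauEnvelope {n : ℕ} (X : Set (Vec n)) (h : Vec n → ℝ) (t : ℝ) (x : Vec n) : ℝ :=
  ⨅ y : X, (h y + ‖(y : Vec n) - x‖ ^ 2 / (2 * t))

/-- `p` is the Euclidean projection of `x` onto `X` (unique when `X` is closed and convex). -/
def IsProj {n : ℕ} (X : Set (Vec n)) (x p : Vec n) : Prop :=
  p ∈ X ∧ ∀ z ∈ X, ‖x - p‖ ≤ ‖x - z‖

/-- The average `x̄ = (1/N) ∑ᵢ xᵢ` of the agents' iterates. -/
def average {n N : ℕ} (x : Fin N → Vec n) : Vec n :=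
  (N : ℝ)⁻¹ • ∑ i, x i

/-- The local mixing step `vᵢ = ∑ⱼ aᵢⱼ xⱼ`. -/
def mix {n N : ℕ} (A : Matrix (Fin N) (Fin N) ℝ) (x : Fin N → Vec n) (i : Fin N) : Vec n :=
  ∑ j, A i j • x j

/-- `(j, i)` is an edge used infinitely often: agent `j` sends to agent `i` at infinitely many
times `k` (agent `j` sends to agent `i` at time `k` when `aᵢⱼ(k) > 0`). -/
def PersistentEdge {N : ℕ} (A : ℕ → Matrix (Fin N) (Fin N) ℝ) (j i : Fin N) : Prop :=
  ∃ᶠ k in atTop, 0 < A k i j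

/-- Assumptions on the time-varying network and its weight matrices. -/
structure Network {N : ℕ} (η : ℝ) (B : ℕ) (A : ℕ → Matrix (Fin N) (Fin N) ℝ) : Prop where
  /-- every agent gives its own value a weight of at least `η` -/
  diag : ∀ k i, η ≤ A k i i
  /-- every weight is zero or at least `η` -/
  weight : ∀ k i j, A k i j = 0 ∨ η ≤ A k i j
  /-- row sums are one -/
  row_sum : ∀ k i, ∑ j, A k i j = 1
  /-- column sums are one -/
  col_sum : ∀ k j, ∑ i, A k i j = 1
  /-- the graph of the edges used infinitely often is (strongly) connected -/
  connected : ∀ i j, Relation.ReflTransGen (PersistentEdge A) i j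
  /-- each of these edges is used at least once in every `B` consecutive time slots -/
  intercomm : ∀ j i, PersistentEdge A j i → ∀ k, ∃ l, k ≤ l ∧ l < k + B ∧ 0 < A l i j

/-- `transition A s m = Φ(s + m, s) = A(s + m) ⋯ A(s + 1) A(s)`. -/
def transition {N : ℕ} (A : ℕ → Matrix (Fin N) (Fin N) ℝ) (s : ℕ) :
    ℕ → Matrix (Fin N) (Fin N) ℝ
  | 0 => A s
  | m + 1 => A (s + m + 1) * transition A s m

/-- The averaging matrix `J = (1/N) 𝟏𝟏ᵀ`. -/
def averagingMatrix (N : ℕ) : Matrix (Fin N) (Fin N) ℝ :=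
  fun _ _ => (N : ℝ)⁻¹

/-- `‖Φ(k, s) - J‖ ≤ c λ^(k - s)` in operator norm for all `k ≥ s ≥ 0`, with `c > 0` and
`λ ∈ (0, 1)` (here `r` stands for `λ`). -/
def MixesAtRate {N : ℕ} (A : ℕ → Matrix (Fin N) (Fin N) ℝ) (c r : ℝ) : Prop :=
  0 < c ∧ 0 < r ∧ r < 1 ∧
    ∀ s m : ℕ,
      ‖Matrix.toEuclideanCLM (n := Fin N) (𝕜 := ℝ) (transition A s m - averagingMatrix N)‖
        ≤ c * r ^ m

/-- Assumptions on the problem `min_{x ∈ X} (1/N) ∑ᵢ fᵢ(x)`. -/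
structure Problem {n N : ℕ} (ρ : ℝ) (L : ℝ≥0) (X : Set (Vec n)) (f : Fin N → Vec n → ℝ) :
    Prop where
  closed : IsClosed X
  convex : Convex ℝ X
  weaklyConvex : ∀ i, WeaklyConvex ρ (f i)
  lipschitz : ∀ i, LipschitzOnWith L (f i) X
  bddBelow : BddBelow (objective f '' X)

/-- The iterates `x k i` are produced by the stochastic distributed projected subgradient method
`x_{i,k+1} = Proj_X(v_{i,k} - α_k ξ_{i,k})`, `v_{i,k} = ∑ⱼ aᵢⱼ(k) x_{j,k}`,
with unbiased stochastic subgradients `ξ k i` of second moment at most `L²`; the σ-algebra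
`ℱ k` contains the information available before the draws of step `k`. -/
structure Run {n N : ℕ} {Ω : Type u} [mΩ : MeasurableSpace Ω] (μ : Measure Ω)
    (ℱ : Filtration ℕ mΩ) (L : ℝ≥0) (X : Set (Vec n)) (f : Fin N → Vec n → ℝ)
    (A : ℕ → Matrix (Fin N) (Fin N) ℝ) (α : ℕ → ℝ)
    (ξ x : ℕ → Fin N → Ω → Vec n) : Prop where
  step_pos : ∀ k, 0 < α k
  init_mem : ∀ i ω, x 0 i ω ∈ X
  init_meas : ∀ i, StronglyMeasurable[ℱ 0] (x 0 i)
  init_sq : ∀ i, MemLp (x 0 i) 2 μ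
  update : ∀ k i ω,
    IsProj X (mix (A k) (fun j => x k j ω) i - α k • ξ k i ω) (x (k + 1) i ω)
  noise_meas : ∀ k i, StronglyMeasurable[ℱ (k + 1)] (ξ k i)
  noise_sq : ∀ k i, MemLp (ξ k i) 2 μ
  unbiased : ∀ k i, ∀ᵐ ω ∂μ,
    (μ[ξ k i | ℱ k]) ω ∈ subdifferential (f i) (mix (A k) (fun j => x k j ω) i)
  second_moment : ∀ k i, ∫ ω, ‖ξ k i ω‖ ^ 2 ∂μ ≤ (L : ℝ) ^ 2

end StoDPSM

end

/-!
The expected Moreau envelope of the average, `E φₜ(x̄ₖ)`, is a Lyapunov function. Let `z` be the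
proximal point of `x̄ₖ`, the minimizer over `X` of `f + ‖· - x̄ₖ‖² / (2t)`, so that
`∇φₜ(x̄ₖ) = (x̄ₖ - z) / t`. Testing the infimum that defines `φₜ(x̄ₖ₊₁)` with `z`, and using that the
projection is nonexpansive and that the mixed points `vᵢ` have mean `x̄ₖ`, gives
`φₜ(x̄ₖ₊₁) ≤ φₜ(x̄ₖ) + (2tN)⁻¹ ∑ᵢ (‖vᵢ - x̄ₖ‖² + 2α ⟪z - vᵢ, ξᵢ⟫ + α² ‖ξᵢ‖²)`
(`ProxRegular.moreauEnvelope_average_le`). In expectation `ξᵢ` may be replaced by its conditional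
mean, a subgradient of `fᵢ` at `vᵢ`. For weakly convex functions the Fréchet subgradient inequality
is global up to a quadratic term (`WeaklyConvex.subgradient_le`), and `f` decreases quadratically
from `x̄ₖ` to `z` by strong convexity of the proximal objective (`ProxRegular.proxPoint_decrease`).
Since `2ρt < 1` these combine to the descent inequality
`(α/2) E‖∇φₜ(x̄ₖ)‖² ≤ E φₜ(x̄ₖ) - E φₜ(x̄ₖ₊₁) + K E (1/N) ∑ᵢ ‖vᵢ - x̄ₖ‖² + α² L² / t`
(`Run.integral_descent`).

The disagreement `∑ᵢ ‖vᵢ - x̄ₖ‖²` is controlled by the mixing of the network. The iteration is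
`xₖ₊₁ = A(k) xₖ + eₖ` with `‖e_{i,k}‖ ≤ αₖ ‖ξ_{i,k}‖`, so the mixing rate turns it into a scalar
recursion with factor `r` (`norm_disagreement_le`), whose squares sum to
`O(1) + O(L² (1 - r)⁻² ∑ αₖ²)` (`Run.sum_integral_disagreement_le`). Summing the descent inequality
yields `∑ αₖ E‖∇φₜ(x̄ₖ)‖² ≤ D + K' L² (1 - r)⁻² ∑ αₖ²` with `K'` depending only on `ρ`, `t`, the
mixing constant `c` and a bound for the step sizes (`Run.sum_step_mul_gradient_le`). For square-summable steps the right
side is bounded, which gives the `liminf`, and `E φₜ(x̄ₖ)` converges as it is almost decreasing.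
For steps of order `1/√k` the left side is at least `√T` times the smallest gradient, up to a
constant, and the right side grows like `log T`, so that for large `T` it absorbs `D`; when `L = 0`
all the gradients vanish.

Geometric mixing itself (`Network.exists_mixesAtRate`) holds because the set of agents reached from
a given one grows at least by one in every `B` steps until it is everything
(`Network.le_reached_card`). So products over `N B + 1` steps have entries bounded below, and a
doubly stochastic matrix with this property contracts vectors of mean zero
(`norm_sub_averagingMatrix_le`).
-/

noncomputable section

namespace StoDPSM

section

/-! ### Weakly convex functions and their subgradients -/

/-- An estimate with a linear error term that holds for all small `s > 0` holds without it. -/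
theorem le_of_forall_le_add_mul {a b c : ℝ} (h : ∀ s : ℝ, 0 < s → s < 1 → a ≤ b + s * c) :
    a ≤ b := by
  have h1 : Tendsto (fun s : ℝ => b + s * c) (𝓝[>] 0) (𝓝 (b + 0 * c)) :=
    tendsto_nhdsWithin_of_tendsto_nhds (by
      have : Continuous (fun s : ℝ => b + s * c) := by fun_prop
      exact this.tendsto 0)
  have h2 : ∀ᶠ s : ℝ in 𝓝[>] 0, a ≤ b + s * c := by
    filter_upwards [Ioo_mem_nhdsGT (zero_lt_one' ℝ)] with s hs using h s hs.1 hs.2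
  simpa using ge_of_tendsto h1 h2

theorem norm_segment_sq {n : ℕ} (x y : Vec n) (s : ℝ) :
    ‖x + s • (y - x)‖ ^ 2 = (1 - s) * ‖x‖ ^ 2 + s * ‖y‖ ^ 2 - s * (1 - s) * ‖y - x‖ ^ 2 := by
  have h1 : ‖x + s • (y - x)‖ ^ 2
      = ‖x‖ ^ 2 + 2 * (s * inner ℝ x (y - x)) + s ^ 2 * ‖y - x‖ ^ 2 := by
    rw [norm_add_sq_real, inner_smul_right, norm_smul, mul_pow, Real.norm_eq_abs, sq_abs]
  have h2 : ‖y‖ ^ 2 = ‖x‖ ^ 2 + 2 * inner ℝ x (y - x) + ‖y - x‖ ^ 2 := by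
    rw [← norm_add_sq_real]; congr 2; abel
  rw [h1, h2]; ring

namespace WeaklyConvex

variable {n : ℕ} {ρ : ℝ} {f : Vec n → ℝ}

theorem continuous (hf : WeaklyConvex ρ f) : Continuous f := by
  have h1 : Continuous (fun x => f x + ρ / 2 * ‖x‖ ^ 2) := by
    have := ConvexOn.continuousOn isOpen_univ hf
    exact continuousOn_univ.1 this
  have h2 : f = fun x => (f x + ρ / 2 * ‖x‖ ^ 2) - ρ / 2 * ‖x‖ ^ 2 := by ext; ring
  rw [h2]
  fun_prop

/-- Weak convexity as a convexity inequality along segments with a quadratic defect. -/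
theorem segment_le (hf : WeaklyConvex ρ f) (x y : Vec n) {s : ℝ} (h0 : 0 ≤ s) (h1 : s ≤ 1) :
    f (x + s • (y - x)) ≤ (1 - s) * f x + s * f y + ρ / 2 * (s * (1 - s) * ‖y - x‖ ^ 2) := by
  have h := hf.2 (mem_univ x) (mem_univ y) (sub_nonneg.2 h1) h0 (by ring)
  have e : (1 - s) • x + s • y = x + s • (y - x) := by
    rw [sub_smul, smul_sub, one_smul]; abel
  simp only [e, smul_eq_mul, norm_segment_sq] at h
  linarith

/-- For a weakly convex function the local Fréchet subgradient inequality is global, up to a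
quadratic term. -/
theorem subgradient_le (hf : WeaklyConvex ρ f) {x g : Vec n} (hg : g ∈ subdifferential f x)
    (y : Vec n) : f x + inner ℝ g (y - x) - ρ / 2 * ‖y - x‖ ^ 2 ≤ f y := by
  have key : ∀ ε : ℝ, 0 < ε →
      f x + inner ℝ g (y - x) - ρ / 2 * ‖y - x‖ ^ 2 ≤ f y + ε * ‖y - x‖ := by
    intro ε hε
    have hcont : Tendsto (fun s : ℝ => x + s • (y - x)) (𝓝[>] 0) (𝓝 x) := by
      have : Continuous (fun s : ℝ => x + s • (y - x)) := by fun_prop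
      have h := this.tendsto 0
      simp only [zero_smul, add_zero] at h
      exact tendsto_nhdsWithin_of_tendsto_nhds h
    have hev : ∀ᶠ s : ℝ in 𝓝[>] 0,
        f x + inner ℝ g (y - x) - ρ / 2 * ‖y - x‖ ^ 2 + s * (ρ / 2 * ‖y - x‖ ^ 2)
          ≤ f y + ε * ‖y - x‖ := by
      filter_upwards [hcont.eventually (hg ε hε), Ioo_mem_nhdsGT (zero_lt_one' ℝ)] with s hs hs'
      have h1 := hf.segment_le x y hs'.1.le hs'.2.le
      rw [add_sub_cancel_left, inner_smul_right, norm_smul, Real.norm_eq_abs,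
        abs_of_pos hs'.1] at hs
      have h2 : s * (f x + inner ℝ g (y - x) - ρ / 2 * ‖y - x‖ ^ 2 + s * (ρ / 2 * ‖y - x‖ ^ 2))
          ≤ s * (f y + ε * ‖y - x‖) := by linarith
      exact le_of_mul_le_mul_left h2 hs'.1
    refine le_of_tendsto (x := 𝓝[>] (0 : ℝ)) ?_ hev
    have : Continuous (fun s : ℝ =>
        f x + inner ℝ g (y - x) - ρ / 2 * ‖y - x‖ ^ 2 + s * (ρ / 2 * ‖y - x‖ ^ 2)) := by fun_prop
    have h := this.tendsto 0
    simp only [zero_mul, add_zero] at h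
    exact tendsto_nhdsWithin_of_tendsto_nhds h
  exact le_of_forall_le_add_mul fun s h0 _ => key s h0

theorem objective {N : ℕ} {f : Fin N → Vec n → ℝ} (hN : 0 < N)
    (hf : ∀ i, WeaklyConvex ρ (f i)) : WeaklyConvex ρ (objective f) := by
  have hN' : (0 : ℝ) < N := Nat.cast_pos.2 hN
  refine ⟨convex_univ, fun x _ y _ a b ha hb hab => ?_⟩
  have h := Finset.sum_le_sum fun i (_ : i ∈ Finset.univ) =>
    (hf i).2 (mem_univ x) (mem_univ y) ha hb hab
  simp only [smul_eq_mul, Finset.sum_add_distrib, ← Finset.mul_sum, Finset.sum_const,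
    Finset.card_univ, Fintype.card_fin, nsmul_eq_mul] at h
  simp only [StoDPSM.objective, smul_eq_mul]
  have h' := div_le_div_of_nonneg_right h hN'.le
  convert h' using 1 <;> field_simp

end WeaklyConvex

/-! ### Proximal points and the Moreau envelope -/

/-- The assumptions under which the proximal map of `h + δ_X` is single valued. -/
structure ProxRegular {n : ℕ} (ρ t : ℝ) (X : Set (Vec n)) (h : Vec n → ℝ) : Prop where
  t_pos : 0 < t
  rho_mul_lt : ρ * t < 1
  closed : IsClosed X
  convex : Convex ℝ X
  nonempty : X.Nonempty
  weaklyConvex : WeaklyConvex ρ h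
  bddBelow : BddBelow (h '' X)

/-- The function `y ↦ h(y) + ‖y - x‖² / (2t)` whose infimum over `X` is the Moreau envelope. -/
def proxObjective {n : ℕ} (h : Vec n → ℝ) (t : ℝ) (x y : Vec n) : ℝ :=
  h y + ‖y - x‖ ^ 2 / (2 * t)

/-- The proximal point of `x`: a minimizer of `proxObjective h t x` over `X`. -/
def proxPoint {n : ℕ} (X : Set (Vec n)) (h : Vec n → ℝ) (t : ℝ) (x : Vec n) : Vec n :=
  Classical.epsilon fun p => p ∈ X ∧ ∀ y ∈ X, proxObjective h t x p ≤ proxObjective h t x y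

namespace ProxRegular

variable {n : ℕ} {ρ t : ℝ} {X : Set (Vec n)} {h : Vec n → ℝ}

theorem exists_minimizer (H : ProxRegular ρ t X h) (x : Vec n) :
    ∃ p ∈ X, ∀ y ∈ X, proxObjective h t x p ≤ proxObjective h t x y := by
  obtain ⟨x₀, hx₀⟩ := H.nonempty
  obtain ⟨m, hm⟩ := H.bddBelow
  have ht := H.t_pos
  have hcont : Continuous (proxObjective h t x) := by
    have := H.weaklyConvex.continuous
    unfold proxObjective
    fun_prop
  have hlim : Tendsto (fun y : Vec n => m + ‖y - x‖ ^ 2 / (2 * t)) (cocompact _) atTop := by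
    refine tendsto_atTop_add_const_left _ _ (Tendsto.atTop_div_const (by positivity) ?_)
    have h1 : Tendsto (fun y : Vec n => ‖y - x‖) (cocompact _) atTop := by
      have := tendsto_norm_cocompact_atTop (E := Vec n)
      have h2 : Tendsto (fun y : Vec n => ‖y‖ - ‖x‖) (cocompact _) atTop :=
        tendsto_atTop_add_const_right _ _ this
      exact tendsto_atTop_mono (fun y => norm_sub_norm_le y x) h2
    exact (tendsto_pow_atTop two_ne_zero).comp h1
  obtain ⟨p, hp, hmin⟩ := hcont.continuousOn.exists_isMinOn' H.closed hx₀ (by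
    rw [eventually_inf_principal]
    filter_upwards [hlim.eventually_ge_atTop (proxObjective h t x x₀)] with y hy hyX
    refine hy.trans ?_
    unfold proxObjective
    gcongr
    exact hm (mem_image_of_mem h hyX))
  exact ⟨p, hp, fun y hy => hmin hy⟩

theorem proxPoint_spec (H : ProxRegular ρ t X h) (x : Vec n) :
    proxPoint X h t x ∈ X ∧
      ∀ y ∈ X, proxObjective h t x (proxPoint X h t x) ≤ proxObjective h t x y :=
  Classical.epsilon_spec
    (p := fun p => p ∈ X ∧ ∀ y ∈ X, proxObjective h t x p ≤ proxObjective h t x y)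
    (H.exists_minimizer x)

theorem proxPoint_mem (H : ProxRegular ρ t X h) (x : Vec n) : proxPoint X h t x ∈ X :=
  (H.proxPoint_spec x).1

/-- Quadratic growth at a minimizer: `proxObjective h t x` is `(1/t - ρ)`-strongly convex. -/
theorem growth (H : ProxRegular ρ t X h) {x p : Vec n} (hp : p ∈ X)
    (hmin : ∀ y ∈ X, proxObjective h t x p ≤ proxObjective h t x y) {y : Vec n} (hy : y ∈ X) :
    proxObjective h t x p + (1 / t - ρ) / 2 * ‖y - p‖ ^ 2 ≤ proxObjective h t x y := by
  have ht := H.t_pos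
  refine le_of_forall_le_add_mul (c := (1 / t - ρ) / 2 * ‖y - p‖ ^ 2) fun s h0 h1 => ?_
  have hmem : p + s • (y - p) ∈ X := H.convex.add_smul_sub_mem hp hy ⟨h0.le, h1.le⟩
  have h2 := hmin _ hmem
  have h3 := H.weaklyConvex.segment_le p y h0.le h1.le
  have h4 := norm_segment_sq (p - x) (y - x) s
  rw [sub_sub_sub_cancel_right, show p - x + s • (y - p) = p + s • (y - p) - x by abel] at h4
  unfold proxObjective at h2 ⊢
  rw [h4] at h2
  have h5 : s * (h p + ‖p - x‖ ^ 2 / (2 * t) + (1 / t - ρ) / 2 * ‖y - p‖ ^ 2) ≤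
      s * (h y + ‖y - x‖ ^ 2 / (2 * t) + s * ((1 / t - ρ) / 2 * ‖y - p‖ ^ 2)) := by
    have e : ((1 - s) * ‖p - x‖ ^ 2 + s * ‖y - x‖ ^ 2 - s * (1 - s) * ‖y - p‖ ^ 2) / (2 * t)
        = (1 - s) * (‖p - x‖ ^ 2 / (2 * t)) + s * (‖y - x‖ ^ 2 / (2 * t))
          - s * (1 - s) * (1 / t / 2 * ‖y - p‖ ^ 2) := by field_simp
    rw [e] at h2
    linarith
  exact le_of_mul_le_mul_left h5 h0

theorem modulus_pos (H : ProxRegular ρ t X h) : 0 < 1 / t - ρ := by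
  have := H.t_pos
  rw [sub_pos, lt_div_iff₀ this]
  exact H.rho_mul_lt

/-- The minimizer is unique. -/
theorem eq_proxPoint (H : ProxRegular ρ t X h) {x p : Vec n} (hp : p ∈ X)
    (hmin : ∀ y ∈ X, proxObjective h t x p ≤ proxObjective h t x y) :
    p = proxPoint X h t x := by
  have h1 := H.growth hp hmin (H.proxPoint_mem x)
  have h2 := (H.proxPoint_spec x).2 p hp
  have h3 := H.modulus_pos
  have h4 : ‖proxPoint X h t x - p‖ ^ 2 ≤ 0 := by
    by_contra hcon
    push Not at hcon
    nlinarith [mul_pos h3 hcon]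
  have h5 : ‖proxPoint X h t x - p‖ = 0 := by
    have := sq_nonneg ‖proxPoint X h t x - p‖
    exact pow_eq_zero_iff two_ne_zero |>.1 (le_antisymm h4 this)
  exact (sub_eq_zero.1 (norm_eq_zero.1 h5)).symm

theorem moreauEnvelope_eq (H : ProxRegular ρ t X h) (x : Vec n) :
    moreauEnvelope X h t x = proxObjective h t x (proxPoint X h t x) := by
  have hs := H.proxPoint_spec x
  have : Nonempty X := ⟨⟨_, hs.1⟩⟩
  refine le_antisymm ?_ (le_ciInf fun y => hs.2 y y.2)
  exact ciInf_le (f := fun y : X => proxObjective h t x y)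
    ⟨_, by rintro _ ⟨y, rfl⟩; exact hs.2 y y.2⟩ (⟨_, hs.1⟩ : X)

theorem moreauEnvelope_le (H : ProxRegular ρ t X h) (x : Vec n) {y : Vec n} (hy : y ∈ X) :
    moreauEnvelope X h t x ≤ h y + ‖y - x‖ ^ 2 / (2 * t) := by
  rw [H.moreauEnvelope_eq]
  exact (H.proxPoint_spec x).2 y hy

/-- The proximal map is Lipschitz: add the growth inequalities at the two proximal points. -/
theorem norm_proxPoint_sub_le (H : ProxRegular ρ t X h) (x y : Vec n) :
    (1 - ρ * t) * ‖proxPoint X h t y - proxPoint X h t x‖ ≤ ‖y - x‖ := by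
  have ht := H.t_pos
  set p := proxPoint X h t x
  set q := proxPoint X h t y
  have h1 := H.growth (H.proxPoint_spec x).1 (H.proxPoint_spec x).2 (H.proxPoint_mem y)
  have h2 := H.growth (H.proxPoint_spec y).1 (H.proxPoint_spec y).2 (H.proxPoint_mem x)
  change proxObjective h t x p + (1 / t - ρ) / 2 * ‖q - p‖ ^ 2 ≤ proxObjective h t x q at h1
  change proxObjective h t y q + (1 / t - ρ) / 2 * ‖p - q‖ ^ 2 ≤ proxObjective h t y p at h2
  unfold proxObjective at h1 h2
  rw [norm_sub_rev p q] at h2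
  have h3 : ‖q - x‖ ^ 2 - ‖p - x‖ ^ 2 + ‖p - y‖ ^ 2 - ‖q - y‖ ^ 2
      = 2 * inner ℝ (q - p) (y - x) := by
    simp only [norm_sub_sq_real, inner_sub_left, inner_sub_right]
    ring
  have h4 : (1 / t - ρ) * ‖q - p‖ ^ 2 ≤ inner ℝ (q - p) (y - x) / t := by
    have : (1 / t - ρ) * ‖q - p‖ ^ 2 ≤
        (‖q - x‖ ^ 2 - ‖p - x‖ ^ 2 + ‖p - y‖ ^ 2 - ‖q - y‖ ^ 2) / (2 * t) := by
      rw [sub_div, add_div, sub_div]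
      linarith
    rw [h3, mul_div_mul_left _ _ (two_ne_zero)] at this
    exact this
  have h5 : (1 - ρ * t) * ‖q - p‖ ^ 2 ≤ ‖q - p‖ * ‖y - x‖ := by
    have := mul_le_mul_of_nonneg_left h4 ht.le
    have e1 : t * ((1 / t - ρ) * ‖q - p‖ ^ 2) = (1 - ρ * t) * ‖q - p‖ ^ 2 := by field_simp
    have e2 : t * (inner ℝ (q - p) (y - x) / t) = inner ℝ (q - p) (y - x) := by field_simp
    rw [e1, e2] at this
    exact this.trans (real_inner_le_norm _ _)
  rcases (norm_nonneg (q - p)).eq_or_lt with h0 | h0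
  · rw [← h0]; simp
  · have : ‖q - p‖ * ((1 - ρ * t) * ‖q - p‖) ≤ ‖q - p‖ * ‖y - x‖ := by linarith
    exact le_of_mul_le_mul_left this h0

theorem continuous_proxPoint (H : ProxRegular ρ t X h) : Continuous (proxPoint X h t) := by
  have h1 : 0 < 1 - ρ * t := sub_pos.2 H.rho_mul_lt
  refine (LipschitzWith.of_dist_le_mul (K := (1 - ρ * t)⁻¹.toNNReal)
    fun y x => ?_).continuous
  rw [dist_eq_norm, dist_eq_norm, Real.coe_toNNReal _ (by positivity), inv_mul_eq_div,
    le_div_iff₀ h1, mul_comm]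
  exact H.norm_proxPoint_sub_le x y

/-- The quadratic upper model of the envelope. -/
theorem moreauEnvelope_le_model (H : ProxRegular ρ t X h) (x y : Vec n) :
    moreauEnvelope X h t y ≤ moreauEnvelope X h t x
      + inner ℝ (t⁻¹ • (x - proxPoint X h t x)) (y - x) + ‖y - x‖ ^ 2 / (2 * t) := by
  have ht := H.t_pos
  have h1 := H.moreauEnvelope_le y (H.proxPoint_mem x)
  rw [H.moreauEnvelope_eq x]
  unfold proxObjective
  set p := proxPoint X h t x
  have e : ‖p - y‖ ^ 2 = ‖p - x‖ ^ 2 + 2 * inner ℝ (x - p) (y - x) + ‖y - x‖ ^ 2 := by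
    have : p - y = -((x - p) + (y - x)) := by abel
    rw [this, norm_neg, norm_add_sq_real, norm_sub_rev x p]
  rw [e] at h1
  rw [inner_smul_left]
  refine h1.trans (le_of_eq ?_)
  simp only [conj_trivial]
  field_simp
  ring

/-- The envelope is differentiable, with gradient `(x - prox x) / t`: the quadratic upper models
at two points bound the linearization error from both sides, as `prox` is Lipschitz. -/
theorem hasGradientAt (H : ProxRegular ρ t X h) (x : Vec n) :
    HasGradientAt (moreauEnvelope X h t) (t⁻¹ • (x - proxPoint X h t x)) x := by
  have ht := H.t_pos
  have hσ : 0 < 1 - ρ * t := sub_pos.2 H.rho_mul_lt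
  rw [hasGradientAt_iff_hasFDerivAt, hasFDerivAt_iff_isLittleO]
  set K : ℝ := 1 / (2 * t) + t⁻¹ * (1 - ρ * t)⁻¹ + t⁻¹ with hK
  have hbound : ∀ y, ‖moreauEnvelope X h t y - moreauEnvelope X h t x
      - (InnerProductSpace.toDual ℝ (Vec n) (t⁻¹ • (x - proxPoint X h t x))) (y - x)‖
        ≤ K * ‖‖y - x‖ ^ 2‖ := by
    intro y
    rw [InnerProductSpace.toDual_apply_apply, Real.norm_eq_abs, abs_le, Real.norm_eq_abs,
      abs_of_nonneg (sq_nonneg _)]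
    have h1 := H.moreauEnvelope_le_model x y
    have h2 := H.moreauEnvelope_le_model y x
    have h3 : ‖proxPoint X h t y - proxPoint X h t x‖ ≤ (1 - ρ * t)⁻¹ * ‖y - x‖ := by
      rw [inv_mul_eq_div, le_div_iff₀ hσ, mul_comm]
      exact H.norm_proxPoint_sub_le x y
    set p := proxPoint X h t x
    set q := proxPoint X h t y
    have h4 : inner ℝ (t⁻¹ • (y - q)) (x - y) = - inner ℝ (t⁻¹ • (x - p)) (y - x)
        - t⁻¹ * ‖y - x‖ ^ 2 + t⁻¹ * inner ℝ (q - p) (y - x) := by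
      rw [← real_inner_self_eq_norm_sq (y - x)]
      simp only [inner_smul_left, inner_sub_left, inner_sub_right, conj_trivial]
      ring
    have h5 : inner ℝ (q - p) (y - x) ≤ (1 - ρ * t)⁻¹ * ‖y - x‖ ^ 2 := by
      refine (real_inner_le_norm _ _).trans ?_
      rw [sq, ← mul_assoc]
      gcongr
    have h6 : t⁻¹ * inner ℝ (q - p) (y - x) ≤ t⁻¹ * (1 - ρ * t)⁻¹ * ‖y - x‖ ^ 2 := by
      rw [mul_assoc]
      gcongr
    have h7 : ‖y - x‖ ^ 2 / (2 * t) = 1 / (2 * t) * ‖y - x‖ ^ 2 := by ring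
    rw [norm_sub_rev x y] at h2
    have h8 : 0 ≤ t⁻¹ * (1 - ρ * t)⁻¹ * ‖y - x‖ ^ 2 := by positivity
    have h9 : 0 ≤ t⁻¹ * ‖y - x‖ ^ 2 := by positivity
    rw [h7] at h1 h2
    constructor
    · rw [hK]; linarith
    · rw [hK]; linarith
  refine (Asymptotics.IsBigO.of_bound K (Eventually.of_forall hbound)).trans_isLittleO ?_
  exact Asymptotics.isLittleO_pow_sub_sub x one_lt_two

theorem differentiable (H : ProxRegular ρ t X h) : Differentiable ℝ (moreauEnvelope X h t) :=
  fun x => (H.hasGradientAt x).differentiableAt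

theorem norm_gradient_sq (H : ProxRegular ρ t X h) (x : Vec n) :
    ‖gradient (moreauEnvelope X h t) x‖ ^ 2 = ‖proxPoint X h t x - x‖ ^ 2 / t ^ 2 := by
  have ht := H.t_pos
  rw [(H.hasGradientAt x).gradient, norm_smul, norm_inv, Real.norm_of_nonneg ht.le, mul_pow,
    inv_pow, norm_sub_rev, inv_mul_eq_div]

theorem iInf_le_moreauEnvelope (H : ProxRegular ρ t X h) (x : Vec n) :
    ⨅ z : X, h z ≤ moreauEnvelope X h t x := by
  have ht := H.t_pos
  rw [H.moreauEnvelope_eq]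
  obtain ⟨m, hm⟩ := H.bddBelow
  have h1 : ⨅ z : X, h z ≤ h (proxPoint X h t x) :=
    ciInf_le (f := fun z : X => h z) ⟨m, by rintro _ ⟨z, rfl⟩; exact hm (mem_image_of_mem h z.2)⟩
      (⟨_, H.proxPoint_mem x⟩ : X)
  unfold proxObjective
  have : 0 ≤ ‖proxPoint X h t x - x‖ ^ 2 / (2 * t) := by positivity
  linarith

/-- Moving from a feasible point to its proximal point decreases `h`. -/
theorem proxPoint_decrease (H : ProxRegular ρ t X h) {x : Vec n} (hx : x ∈ X) :
    h (proxPoint X h t x) - h x ≤ -(1 / t - ρ / 2) * ‖proxPoint X h t x - x‖ ^ 2 := by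
  have ht := H.t_pos
  have h1 := H.growth (H.proxPoint_spec x).1 (H.proxPoint_spec x).2 hx
  unfold proxObjective at h1
  rw [sub_self, norm_zero, norm_sub_rev x] at h1
  have e : ‖proxPoint X h t x - x‖ ^ 2 / (2 * t) = 1 / t / 2 * ‖proxPoint X h t x - x‖ ^ 2 := by
    field_simp
  rw [e] at h1
  simp only [ne_eq, OfNat.ofNat_ne_zero, not_false_eq_true, zero_pow, zero_div, add_zero] at h1
  linarith

theorem norm_proxPoint_sub_self_le (H : ProxRegular ρ t X h) {L : ℝ≥0}
    (hL : LipschitzOnWith L h X) {x : Vec n} (hx : x ∈ X) :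
    ‖proxPoint X h t x - x‖ ≤ 2 * t * L := by
  have ht := H.t_pos
  have h1 := (H.proxPoint_spec x).2 x hx
  have h2 := hL.dist_le_mul x hx _ (H.proxPoint_mem x)
  rw [Real.dist_eq, dist_eq_norm, norm_sub_rev] at h2
  unfold proxObjective at h1
  rw [sub_self, norm_zero] at h1
  set d := ‖proxPoint X h t x - x‖
  have h3 : d ^ 2 / (2 * t) ≤ L * d := by
    have := le_abs_self (h x - h (proxPoint X h t x))
    simp only [ne_eq, OfNat.ofNat_ne_zero, not_false_eq_true, zero_pow, zero_div, add_zero] at h1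
    linarith
  rw [div_le_iff₀ (by positivity)] at h3
  rcases (norm_nonneg (proxPoint X h t x - x)).eq_or_lt with h0 | h0
  · change 0 = d at h0
    rw [← h0]; positivity
  · have : d * d ≤ d * (2 * t * L) := by linarith
    exact le_of_mul_le_mul_left this h0

theorem abs_moreauEnvelope_sub_le (H : ProxRegular ρ t X h) {L : ℝ≥0}
    (hL : LipschitzOnWith L h X) {x y : Vec n} (hx : x ∈ X) (hy : y ∈ X) :
    |moreauEnvelope X h t x - moreauEnvelope X h t y|
      ≤ 2 * L * ‖x - y‖ + ‖x - y‖ ^ 2 / (2 * t) := by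
  have ht := H.t_pos
  have key : ∀ x y, x ∈ X → moreauEnvelope X h t y - moreauEnvelope X h t x
      ≤ 2 * L * ‖y - x‖ + ‖y - x‖ ^ 2 / (2 * t) := by
    intro x y hx
    have h1 := H.moreauEnvelope_le_model x y
    have h2 : inner ℝ (t⁻¹ • (x - proxPoint X h t x)) (y - x) ≤ 2 * L * ‖y - x‖ := by
      refine (real_inner_le_norm _ _).trans ?_
      rw [norm_smul, norm_inv, Real.norm_of_nonneg ht.le, norm_sub_rev x]
      have h3 := H.norm_proxPoint_sub_self_le hL hx
      refine mul_le_mul_of_nonneg_right ?_ (norm_nonneg _)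
      rw [inv_mul_eq_div, div_le_iff₀ ht]
      linarith
    linarith
  rw [abs_le]
  have h1 := key x y hx
  have h2 := key y x hy
  rw [norm_sub_rev y x] at h1
  constructor <;> linarith

end ProxRegular

/-! ### The Euclidean projection -/

theorem ProxRegular.zero {n : ℕ} {X : Set (Vec n)} (hc : IsClosed X) (hconv : Convex ℝ X)
    (hne : X.Nonempty) : ProxRegular 0 1 X (fun _ => 0) where
  t_pos := one_pos
  rho_mul_lt := by norm_num
  closed := hc
  convex := hconv
  nonempty := hne
  weaklyConvex := by
    unfold WeaklyConvex
    simpa using convexOn_const (0 : ℝ) convex_univ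
  bddBelow := ⟨0, by rintro _ ⟨_, _, rfl⟩; exact le_rfl⟩

/-- The projection is the proximal map of the zero function. -/
theorem IsProj.eq_proxPoint {n : ℕ} {X : Set (Vec n)} (hc : IsClosed X) (hconv : Convex ℝ X)
    {x p : Vec n} (hp : IsProj X x p) : p = proxPoint X (fun _ => 0) 1 x := by
  refine (ProxRegular.zero hc hconv ⟨p, hp.1⟩).eq_proxPoint hp.1 fun y hy => ?_
  have := hp.2 y hy
  rw [norm_sub_rev x, norm_sub_rev x] at this
  unfold proxObjective
  gcongr

theorem IsProj.norm_sub_le {n : ℕ} {X : Set (Vec n)} (hc : IsClosed X) (hconv : Convex ℝ X)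
    {x p z : Vec n} (hp : IsProj X x p) (hz : z ∈ X) : ‖p - z‖ ≤ ‖x - z‖ := by
  have hz' : IsProj X z z := ⟨hz, fun y _ => by simp⟩
  have := (ProxRegular.zero hc hconv ⟨p, hp.1⟩).norm_proxPoint_sub_le z x
  rw [← hp.eq_proxPoint hc hconv, ← hz'.eq_proxPoint hc hconv] at this
  simpa using this

end

section

/-! ### Geometric mixing of products of the weight matrices -/

open Matrix

theorem norm_toEuclideanCLM_le {N : ℕ} (M : Matrix (Fin N) (Fin N) ℝ) {b : ℝ} (hb : 0 ≤ b)
    (h : ∀ y : Fin N → ℝ, ∑ i, (M *ᵥ y) i ^ 2 ≤ b ^ 2 * ∑ i, y i ^ 2) :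
    ‖Matrix.toEuclideanCLM (n := Fin N) (𝕜 := ℝ) M‖ ≤ b := by
  refine ContinuousLinearMap.opNorm_le_bound _ hb fun y => ?_
  refine le_of_sq_le_sq ?_ (by positivity)
  rw [mul_pow, EuclideanSpace.norm_sq_eq, EuclideanSpace.norm_sq_eq]
  simpa only [Real.norm_eq_abs, sq_abs, Matrix.ofLp_toEuclideanCLM] using h y.ofLp

theorem sum_mulVec_sq_le {N : ℕ} (M : Matrix (Fin N) (Fin N) ℝ) {b : ℝ}
    (h : ‖Matrix.toEuclideanCLM (n := Fin N) (𝕜 := ℝ) M‖ ≤ b) (y : Fin N → ℝ) :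
    ∑ i, (M *ᵥ y) i ^ 2 ≤ b ^ 2 * ∑ i, y i ^ 2 := by
  have h1 := ContinuousLinearMap.le_of_opNorm_le _ h (WithLp.toLp 2 y)
  have h2 := pow_le_pow_left₀ (norm_nonneg _) h1 2
  rw [mul_pow, EuclideanSpace.norm_sq_eq, EuclideanSpace.norm_sq_eq] at h2
  simpa only [Real.norm_eq_abs, sq_abs, Matrix.ofLp_toEuclideanCLM] using h2

/-- A nonnegative matrix all of whose row and column sums are `b` has Euclidean operator norm at
most `b` (by the Cauchy–Schwarz inequality in each row). -/
theorem sum_mulVec_sq_le_of_sums {N : ℕ} {R : Matrix (Fin N) (Fin N) ℝ} {b : ℝ}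
    (h0 : ∀ i j, 0 ≤ R i j) (hr : ∀ i, ∑ j, R i j = b) (hc : ∀ j, ∑ i, R i j = b)
    (y : Fin N → ℝ) : ∑ i, (R *ᵥ y) i ^ 2 ≤ b ^ 2 * ∑ i, y i ^ 2 := by
  have h1 : ∀ i, (R *ᵥ y) i ^ 2 ≤ b * ∑ j, R i j * y j ^ 2 := by
    intro i
    change (∑ j, R i j * y j) ^ 2 ≤ _
    rw [← hr i]
    exact Finset.sum_sq_le_sum_mul_sum_of_sq_le_mul _
      (fun j _ => h0 i j) (fun j _ => mul_nonneg (h0 i j) (sq_nonneg _))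
      (fun j _ => le_of_eq (by ring))
  calc ∑ i, (R *ᵥ y) i ^ 2 ≤ ∑ i, b * ∑ j, R i j * y j ^ 2 := Finset.sum_le_sum fun i _ => h1 i
    _ = b * ∑ j, (∑ i, R i j) * y j ^ 2 := by
        rw [← Finset.mul_sum, Finset.sum_comm]
        simp only [Finset.sum_mul]
    _ = b ^ 2 * ∑ i, y i ^ 2 := by simp only [hc, ← Finset.mul_sum]; ring

theorem averagingMatrix_mulVec {N : ℕ} (y : Fin N → ℝ) (i : Fin N) :
    (averagingMatrix N *ᵥ y) i = (N : ℝ)⁻¹ * ∑ j, y j := by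
  simp [averagingMatrix, Matrix.mulVec, dotProduct, Finset.mul_sum]

/-- Subtracting the mean does not increase the Euclidean norm. -/
theorem sum_sub_mean_sq_le {N : ℕ} (y : Fin N → ℝ) :
    ∑ i, (y i - (N : ℝ)⁻¹ * ∑ j, y j) ^ 2 ≤ ∑ i, y i ^ 2 := by
  rcases Nat.eq_zero_or_pos N with rfl | hN
  · simp
  have hN' : (N : ℝ) ≠ 0 := by positivity
  have e : ∑ i, (y i - (N : ℝ)⁻¹ * ∑ j, y j) ^ 2
      = ∑ i, y i ^ 2 - (N : ℝ)⁻¹ * (∑ j, y j) ^ 2 := by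
    simp only [sub_sq, Finset.sum_add_distrib, Finset.sum_sub_distrib, ← Finset.sum_mul,
      ← Finset.mul_sum, Finset.sum_const, Finset.card_univ, Fintype.card_fin, nsmul_eq_mul]
    field_simp
    ring
  rw [e]
  have : 0 ≤ (N : ℝ)⁻¹ * (∑ j, y j) ^ 2 := by positivity
  linarith

theorem sum_sub_mean {N : ℕ} (hN : 0 < N) (y : Fin N → ℝ) :
    ∑ i, (y i - (N : ℝ)⁻¹ * ∑ j, y j) = 0 := by
  have hN' : (N : ℝ) ≠ 0 := by positivity
  simp only [Finset.sum_sub_distrib, Finset.sum_const, Finset.card_univ, Fintype.card_fin,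
    nsmul_eq_mul]
  field_simp
  ring

/-- If a doubly stochastic matrix has all entries at least `δ`, then it contracts towards the
average with factor `1 - N δ`: the part `δ 𝟏𝟏ᵀ` kills vectors of mean zero. -/
theorem norm_sub_averagingMatrix_le {N : ℕ} (hN : 0 < N) {M : Matrix (Fin N) (Fin N) ℝ} {δ : ℝ}
    (h0 : ∀ i j, δ ≤ M i j) (hr : ∀ i, ∑ j, M i j = 1) (hc : ∀ j, ∑ i, M i j = 1) :
    ‖Matrix.toEuclideanCLM (n := Fin N) (𝕜 := ℝ) (M - averagingMatrix N)‖ ≤ 1 - N * δ := by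
  have hN' : (N : ℝ) ≠ 0 := by positivity
  set R : Matrix (Fin N) (Fin N) ℝ := fun i j => M i j - δ with hR
  have hr' : ∀ i, ∑ j, R i j = 1 - N * δ := fun i => by
    simp [hR, Finset.sum_sub_distrib, hr]
  have hc' : ∀ j, ∑ i, R i j = 1 - N * δ := fun j => by
    simp [hR, Finset.sum_sub_distrib, hc]
  have hb : 0 ≤ 1 - N * δ := by
    rw [← hr' ⟨0, hN⟩]
    exact Finset.sum_nonneg fun j _ => sub_nonneg.2 (h0 _ j)
  refine norm_toEuclideanCLM_le _ hb fun y => ?_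
  set z : Fin N → ℝ := fun i => y i - (N : ℝ)⁻¹ * ∑ j, y j with hz
  have hz0 : ∑ i, z i = 0 := sum_sub_mean hN y
  have e : ∀ i, ((M - averagingMatrix N) *ᵥ y) i = (R *ᵥ z) i := by
    intro i
    have e1 : (R *ᵥ z) i = ∑ j, M i j * z j := by
      simp only [hR, Matrix.mulVec, dotProduct, sub_mul, Finset.sum_sub_distrib,
        ← Finset.mul_sum, hz0, mul_zero, sub_zero]
    rw [e1, Matrix.sub_mulVec, Pi.sub_apply, averagingMatrix_mulVec]
    simp only [hz, mul_sub, Finset.sum_sub_distrib, ← Finset.sum_mul, hr, one_mul]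
    rfl
  simp only [e]
  refine (sum_mulVec_sq_le_of_sums (fun i j => sub_nonneg.2 (h0 i j)) hr' hc' z).trans ?_
  exact mul_le_mul_of_nonneg_left (sum_sub_mean_sq_le y) (sq_nonneg _)

theorem mul_averagingMatrix {N : ℕ} {M : Matrix (Fin N) (Fin N) ℝ} (hr : ∀ i, ∑ j, M i j = 1) :
    M * averagingMatrix N = averagingMatrix N := by
  ext i j
  simp [Matrix.mul_apply, averagingMatrix, ← Finset.sum_mul, hr]

theorem averagingMatrix_mul {N : ℕ} {M : Matrix (Fin N) (Fin N) ℝ} (hc : ∀ j, ∑ i, M i j = 1) :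
    averagingMatrix N * M = averagingMatrix N := by
  ext i j
  simp [Matrix.mul_apply, averagingMatrix, ← Finset.mul_sum, hc]

theorem row_sum_mul {N : ℕ} {M K : Matrix (Fin N) (Fin N) ℝ} (hM : ∀ i, ∑ j, M i j = 1)
    (hK : ∀ i, ∑ j, K i j = 1) (i : Fin N) : ∑ j, (M * K) i j = 1 := by
  simp only [Matrix.mul_apply]
  rw [Finset.sum_comm]
  simp [← Finset.mul_sum, hK, hM]

theorem col_sum_mul {N : ℕ} {M K : Matrix (Fin N) (Fin N) ℝ} (hM : ∀ j, ∑ i, M i j = 1)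
    (hK : ∀ j, ∑ i, K i j = 1) (j : Fin N) : ∑ i, (M * K) i j = 1 := by
  simp only [Matrix.mul_apply]
  rw [Finset.sum_comm]
  simp [← Finset.sum_mul, hK, hM]

/-- `transition A s m` has `m + 1` factors, so the two products overlap in no factor. -/
theorem transition_add {N : ℕ} (A : ℕ → Matrix (Fin N) (Fin N) ℝ) (s k m : ℕ) :
    transition A s (m + k + 1) = transition A (s + k + 1) m * transition A s k := by
  induction m with
  | zero => simp [transition]
  | succ m ih =>
    rw [show m + 1 + k + 1 = (m + k + 1) + 1 by ring, transition, ih, transition, Matrix.mul_assoc]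
    congr 2
    ring

namespace Network

variable {N : ℕ} {η : ℝ} {B : ℕ} {A : ℕ → Matrix (Fin N) (Fin N) ℝ}

theorem nonneg (hA : Network η B A) (hη : 0 < η) (k : ℕ) (i j : Fin N) : 0 ≤ A k i j := by
  rcases hA.weight k i j with h | h
  · exact h.ge
  · exact hη.le.trans h

theorem transition_row_sum (hA : Network η B A) (s m : ℕ) (i : Fin N) :
    ∑ j, transition A s m i j = 1 := by
  induction m generalizing i with
  | zero => exact hA.row_sum s i
  | succ m ih => exact row_sum_mul (hA.row_sum _) ih i

theorem transition_col_sum (hA : Network η B A) (s m : ℕ) (j : Fin N) :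
    ∑ i, transition A s m i j = 1 := by
  induction m generalizing j with
  | zero => exact hA.col_sum s j
  | succ m ih => exact col_sum_mul (hA.col_sum _) ih j

theorem transition_nonneg (hA : Network η B A) (hη : 0 < η) (s m : ℕ) (i j : Fin N) :
    0 ≤ transition A s m i j := by
  induction m generalizing i j with
  | zero => exact hA.nonneg hη s i j
  | succ m ih =>
    rw [transition, Matrix.mul_apply]
    exact Finset.sum_nonneg fun l _ => mul_nonneg (hA.nonneg hη _ _ _) (ih _ _)

/-- A positive weight used at the next step transports the lower bound on an entry. -/
theorem pow_le_transition_succ (hA : Network η B A) (hη : 0 < η) {s m : ℕ} {i l j : Fin N}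
    (h1 : 0 < A (s + m + 1) i l) (h2 : η ^ (m + 1) ≤ transition A s m l j) :
    η ^ (m + 2) ≤ transition A s (m + 1) i j := by
  have h3 : η ≤ A (s + m + 1) i l := (hA.weight _ _ _).resolve_left h1.ne'
  calc η ^ (m + 2) = η * η ^ (m + 1) := by ring
    _ ≤ A (s + m + 1) i l * transition A s m l j :=
        mul_le_mul h3 h2 (by positivity) h1.le
    _ ≤ ∑ l, A (s + m + 1) i l * transition A s m l j :=
        Finset.single_le_sum (f := fun l => A (s + m + 1) i l * transition A s m l j)
          (fun l _ => mul_nonneg (hA.nonneg hη _ _ _) (hA.transition_nonneg hη _ _ _ _))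
          (Finset.mem_univ l)

/-- The agents that have heard from agent `j` during the time slots `s, …, s + m`, with the
weight that this guarantees. -/
def reached (η : ℝ) (A : ℕ → Matrix (Fin N) (Fin N) ℝ) (s m : ℕ) (j : Fin N) : Finset (Fin N) :=
  open Classical in Finset.univ.filter fun i => η ^ (m + 1) ≤ transition A s m i j

theorem mem_reached {s m : ℕ} {i j : Fin N} :
    i ∈ reached η A s m j ↔ η ^ (m + 1) ≤ transition A s m i j := by
  simp [reached]

theorem reached_mono (hA : Network η B A) (hη : 0 < η) (s : ℕ) (j : Fin N) :
    Monotone fun m => reached η A s m j :=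
  monotone_nat_of_le_succ fun m i hi => by
    rw [mem_reached] at hi ⊢
    exact hA.pow_le_transition_succ hη (hη.trans_le (hA.diag _ i)) hi

theorem self_mem_reached (hA : Network η B A) (hη : 0 < η) (s m : ℕ) (j : Fin N) :
    j ∈ reached η A s m j := by
  refine hA.reached_mono hη s j (Nat.zero_le m) ?_
  rw [mem_reached]
  simpa [transition] using hA.diag s j

/-- A proper subset of the agents is left by some persistent edge. -/
theorem exists_edge_leaving (hA : Network η B A) {S : Finset (Fin N)} {j : Fin N} (hj : j ∈ S)
    (hS : S ≠ Finset.univ) : ∃ a ∈ S, ∃ b ∉ S, PersistentEdge A a b := by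
  by_contra hcon
  push Not at hcon
  refine hS (Finset.eq_univ_iff_forall.2 fun i => ?_)
  have h := hA.connected j i
  induction h with
  | refl => exact hj
  | tail _ hbc ih =>
    by_contra hc
    exact hcon _ ih _ hc hbc

theorem reached_card_lt (hA : Network η B A) (hη : 0 < η) (s m : ℕ) (j : Fin N)
    (h : reached η A s m j ≠ Finset.univ) :
    (reached η A s m j).card < (reached η A s (m + B) j).card := by
  obtain ⟨a, ha, b, hb, hab⟩ := hA.exists_edge_leaving (hA.self_mem_reached hη s m j) h
  obtain ⟨l, hl1, hl2, hl3⟩ := hA.intercomm a b hab (s + m + 1)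
  refine Finset.card_lt_card ⟨hA.reached_mono hη s j (Nat.le_add_right m B), fun hsub => hb ?_⟩
  refine absurd (hsub ?_) hb
  obtain ⟨q, rfl⟩ := Nat.exists_eq_add_of_le hl1
  have h1 : a ∈ reached η A s (m + q) j := hA.reached_mono hη s j (Nat.le_add_right m q) ha
  have h2 : b ∈ reached η A s (m + q + 1) j := by
    rw [mem_reached] at h1 ⊢
    refine hA.pow_le_transition_succ hη (l := a) ?_ h1
    rwa [show s + (m + q) + 1 = s + m + 1 + q by ring]
  exact hA.reached_mono hη s j (by omega) h2

theorem le_reached_card (hA : Network η B A) (hη : 0 < η) (s : ℕ) (j : Fin N) (q : ℕ) :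
    min N (q + 1) ≤ (reached η A s (q * B) j).card := by
  induction q with
  | zero =>
    have : 0 < (reached η A s (0 * B) j).card :=
      Finset.card_pos.2 ⟨j, hA.self_mem_reached hη s _ j⟩
    omega
  | succ q ih =>
    rw [show (q + 1) * B = q * B + B by ring]
    by_cases h : reached η A s (q * B) j = Finset.univ
    · have h1 := Finset.card_le_card (hA.reached_mono hη s j (Nat.le_add_right (q * B) B))
      dsimp only at h1
      rw [h, Finset.card_univ, Fintype.card_fin] at h1
      omega
    · have := hA.reached_card_lt hη s (q * B) j h
      omega

/-- After `N B` further steps every agent has heard from every other one. -/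
theorem pow_le_transition (hA : Network η B A) (hη : 0 < η) (s : ℕ) (i j : Fin N) :
    η ^ (N * B + 1) ≤ transition A s (N * B) i j := by
  rw [← mem_reached]
  have h1 := hA.le_reached_card hη s j N
  have h2 : reached η A s (N * B) j = Finset.univ := by
    refine Finset.eq_univ_of_card _ (le_antisymm (Finset.card_le_univ _) ?_)
    rw [Fintype.card_fin]
    omega
  rw [h2]
  exact Finset.mem_univ i

theorem transition_succ_sub (hA : Network η B A) (s k m : ℕ) :
    transition A s (m + k + 1) - averagingMatrix N
      = (transition A (s + k + 1) m - averagingMatrix N)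
        * (transition A s k - averagingMatrix N) := by
  have h1 := mul_averagingMatrix (hA.transition_row_sum (s + k + 1) m)
  have h2 := averagingMatrix_mul (hA.transition_col_sum s k)
  have h3 : averagingMatrix N * averagingMatrix N = averagingMatrix N :=
    mul_averagingMatrix fun i => by
      have : (N : ℝ) ≠ 0 := by have := i.pos; positivity
      simp [averagingMatrix, this]
  rw [transition_add, Matrix.sub_mul, Matrix.mul_sub, Matrix.mul_sub, h1, h2, h3]
  abel

/-- Over a window of `N B + 1` steps the distance to the averaging matrix contracts by a factor
`b < 1`. With `r` chosen so that `b ≤ r ^ (N B + 1)`, strong induction on the number of steps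
gives the geometric bound. -/
theorem exists_mixesAtRate (N : ℕ) (η : ℝ) (B : ℕ) (hN : 0 < N) (hη : 0 < η) (hη1 : η < 1) :
    ∃ c r : ℝ, ∀ A : ℕ → Matrix (Fin N) (Fin N) ℝ, Network η B A → MixesAtRate A c r := by
  set M : ℕ := N * B + 1 with hM
  set δ : ℝ := η ^ M with hδ
  have hδ0 : 0 < δ := by positivity
  have hδ1 : δ ≤ 1 := pow_le_one₀ hη.le hη1.le
  have hMpos : (1 : ℝ) ≤ M := by rw [hM]; push_cast; linarith [show (0 : ℝ) ≤ N * B by positivity]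
  have hd1 : δ / 2 / M ≤ 1 / 2 := by
    rw [div_le_iff₀ (by linarith)]; nlinarith
  have hd0 : 0 < δ / 2 / M := by positivity
  set r : ℝ := 1 - δ / 2 / M with hr
  have hr0 : 0 < r := by linarith
  have hr1 : r < 1 := by linarith
  have hrM : 1 - δ ≤ r ^ M := by
    have h := one_add_mul_le_pow (a := -(δ / 2 / M)) (by linarith) M
    have e : (M : ℝ) * -(δ / 2 / M) = -(δ / 2) := by field_simp
    rw [e, show 1 + -(δ / 2 / (M : ℝ)) = r from (sub_eq_add_neg _ _).symm] at h
    linarith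
  refine ⟨(r ^ M)⁻¹, r, fun A hA => ⟨by positivity, hr0, hr1, fun s m => ?_⟩⟩
  have hN1 : (1 : ℝ) ≤ N := by exact_mod_cast hN
  have hone : ∀ s m, ‖Matrix.toEuclideanCLM (n := Fin N) (𝕜 := ℝ)
      (transition A s m - averagingMatrix N)‖ ≤ 1 := fun s m => by
    simpa using norm_sub_averagingMatrix_le hN (δ := 0) (hA.transition_nonneg hη s m)
      (hA.transition_row_sum s m) (hA.transition_col_sum s m)
  have hwin : ∀ s, ‖Matrix.toEuclideanCLM (n := Fin N) (𝕜 := ℝ)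
      (transition A s (N * B) - averagingMatrix N)‖ ≤ r ^ M := fun s => by
    refine (norm_sub_averagingMatrix_le hN (hA.pow_le_transition hη s)
      (hA.transition_row_sum s _) (hA.transition_col_sum s _)).trans ?_
    refine le_trans ?_ hrM
    rw [← hM, ← hδ]
    nlinarith
  induction m using Nat.strong_induction_on generalizing s with
  | _ m ih =>
    rcases lt_or_ge m M with h | h
    · refine (hone s m).trans ?_
      rw [inv_mul_eq_div, le_div_iff₀ (by positivity), one_mul]
      exact pow_le_pow_of_le_one hr0.le hr1.le h.le
    · obtain ⟨q, rfl⟩ := Nat.exists_eq_add_of_le h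
      rw [show M + q = q + N * B + 1 by rw [hM]; ring, hA.transition_succ_sub, map_mul]
      refine (norm_mul_le _ _).trans ?_
      calc _ ≤ ((r ^ M)⁻¹ * r ^ q) * r ^ M :=
            mul_le_mul (ih q (by omega) _) (hwin s) (norm_nonneg _) (by positivity)
        _ = (r ^ M)⁻¹ * r ^ (q + N * B + 1) := by
            rw [mul_assoc, ← pow_add, hM, ← add_assoc]

end Network

end

section

/-! ### Consensus -/

variable {n N : ℕ}

theorem mix_mul (M K : Matrix (Fin N) (Fin N) ℝ) (y : Fin N → Vec n) :
    mix (M * K) y = mix M (mix K y) := by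
  ext1 i
  simp only [mix, Matrix.mul_apply, Finset.sum_smul, Finset.smul_sum, smul_smul]
  exact Finset.sum_comm

theorem mix_add (M : Matrix (Fin N) (Fin N) ℝ) (y z : Fin N → Vec n) :
    mix M (y + z) = mix M y + mix M z := by
  ext1 i
  simp [mix, Finset.sum_add_distrib]

theorem mix_sub_averagingMatrix (M : Matrix (Fin N) (Fin N) ℝ) (y : Fin N → Vec n) (i : Fin N) :
    mix (M - averagingMatrix N) y i = mix M y i - average y := by
  simp [mix, averagingMatrix, average, sub_smul, Finset.sum_sub_distrib, Finset.smul_sum]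

theorem sum_norm_mix_sq_le {M : Matrix (Fin N) (Fin N) ℝ} {b : ℝ}
    (h : ‖Matrix.toEuclideanCLM (n := Fin N) (𝕜 := ℝ) M‖ ≤ b) (y : Fin N → Vec n) :
    ∑ i, ‖mix M y i‖ ^ 2 ≤ b ^ 2 * ∑ i, ‖y i‖ ^ 2 := by
  simp only [EuclideanSpace.norm_sq_eq, Real.norm_eq_abs, sq_abs]
  rw [Finset.sum_comm, Finset.sum_comm (f := fun i d => (y i).ofLp d ^ 2), Finset.mul_sum]
  refine Finset.sum_le_sum fun d _ => ?_
  have e : ∀ i, (mix M y i).ofLp d = M.mulVec (fun j => (y j).ofLp d) i := fun i => by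
    simp [mix, Matrix.mulVec, dotProduct]
  simp only [e]
  exact sum_mulVec_sq_le M h fun j => (y j).ofLp d

theorem norm_mix_le {M : Matrix (Fin N) (Fin N) ℝ} {b : ℝ} (hb : 0 ≤ b)
    (h : ‖Matrix.toEuclideanCLM (n := Fin N) (𝕜 := ℝ) M‖ ≤ b) (y : Fin N → Vec n) :
    ‖WithLp.toLp 2 (mix M y)‖ ≤ b * ‖WithLp.toLp 2 y‖ := by
  refine le_of_sq_le_sq ?_ (by positivity)
  rw [mul_pow, PiLp.norm_sq_eq_of_L2, PiLp.norm_sq_eq_of_L2]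
  exact sum_norm_mix_sq_le h y

/-- Averaging at time `k` adds one factor to the product started at time `k + 1`. -/
theorem transition_sub_mul {η : ℝ} {B : ℕ} {A : ℕ → Matrix (Fin N) (Fin N) ℝ}
    (hA : Network η B A) (k m : ℕ) :
    (transition A (k + 1) m - averagingMatrix N) * A k
      = transition A k (m + 1) - averagingMatrix N := by
  have := transition_add A k 0 m
  rw [Matrix.sub_mul, averagingMatrix_mul (hA.col_sum k)]
  simpa [transition] using this.symm

/-- A perturbed averaging recursion `y_{k+1} = A(k) y_k + e_k` stays near consensus. If `u`
dominates the scalar recursion `u_{k+1} = r u_k + ‖e_k‖`, then the mixing rate `c r^m` of the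
network bounds, for all `m` at once, the disagreement left after `m + 1` more averaging steps. -/
theorem norm_disagreement_le {η : ℝ} {B : ℕ} {A : ℕ → Matrix (Fin N) (Fin N) ℝ} {c r : ℝ}
    (hA : Network η B A) (hmix : MixesAtRate A c r) (y : ℕ → Fin N → Vec n) (u : ℕ → ℝ)
    (h0 : ‖WithLp.toLp 2 (y 0)‖ ≤ u 0)
    (hu : ∀ k, r * u k + ‖WithLp.toLp 2 (y (k + 1) - mix (A k) (y k))‖ ≤ u (k + 1)) (k m : ℕ) :
    ‖WithLp.toLp 2 (mix (transition A k m - averagingMatrix N) (y k))‖ ≤ c * r ^ m * u k := by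
  obtain ⟨hc, hr0, hr1, hb⟩ := hmix
  induction k generalizing m with
  | zero =>
    refine (norm_mix_le (by positivity) (hb 0 m) _).trans ?_
    gcongr
  | succ k ih =>
    have e : mix (transition A (k + 1) m - averagingMatrix N) (y (k + 1))
        = mix (transition A k (m + 1) - averagingMatrix N) (y k)
          + mix (transition A (k + 1) m - averagingMatrix N) (y (k + 1) - mix (A k) (y k)) := by
      rw [← transition_sub_mul hA, mix_mul, ← mix_add, add_sub_cancel]
    rw [e, WithLp.toLp_add]
    refine (norm_add_le _ _).trans ?_
    calc _ ≤ c * r ^ (m + 1) * u k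
          + c * r ^ m * ‖WithLp.toLp 2 (y (k + 1) - mix (A k) (y k))‖ :=
          add_le_add (ih (m + 1)) (norm_mix_le (by positivity) (hb (k + 1) m) _)
      _ = c * r ^ m * (r * u k + ‖WithLp.toLp 2 (y (k + 1) - mix (A k) (y k))‖) := by ring
      _ ≤ c * r ^ m * u (k + 1) := by gcongr; exact hu k

/-- The recursion `w_{k+1} = r w_k + b_k / (1 - r)`; by convexity of the square it dominates the
square of `u_{k+1} = r u_k + √b_k`. -/
def discounted (r w₀ : ℝ) (b : ℕ → ℝ) : ℕ → ℝ
  | 0 => w₀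
  | k + 1 => r * discounted r w₀ b k + b k / (1 - r)

theorem discounted_nonneg {r w₀ : ℝ} {b : ℕ → ℝ} (hr0 : 0 < r) (hr1 : r < 1) (hw : 0 ≤ w₀)
    (hb : ∀ k, 0 ≤ b k) (k : ℕ) : 0 ≤ discounted r w₀ b k := by
  induction k with
  | zero => exact hw
  | succ k ih =>
    have := sub_pos.2 hr1
    exact add_nonneg (mul_nonneg hr0.le ih) (div_nonneg (hb k) this.le)

/-- Summing the recursion telescopes to `(1 - r) ∑ w_k + w_T = w₀ + ∑ b_k / (1 - r)`. -/
theorem sum_discounted_le {r w₀ : ℝ} {b : ℕ → ℝ} (hr0 : 0 < r) (hr1 : r < 1) (hw : 0 ≤ w₀)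
    (hb : ∀ k, 0 ≤ b k) (T : ℕ) :
    ∑ k ∈ Finset.range T, discounted r w₀ b k
      ≤ w₀ / (1 - r) + (∑ k ∈ Finset.range T, b k) / (1 - r) ^ 2 := by
  have h1 : 0 < 1 - r := sub_pos.2 hr1
  have key : (1 - r) * ∑ k ∈ Finset.range T, discounted r w₀ b k + discounted r w₀ b T
      = w₀ + (∑ k ∈ Finset.range T, b k) / (1 - r) := by
    induction T with
    | zero => simp [discounted]
    | succ T ih =>
      rw [Finset.sum_range_succ, Finset.sum_range_succ, discounted, add_div]
      linarith
  have h2 := discounted_nonneg hr0 hr1 hw hb T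
  have h3 : w₀ / (1 - r) + (∑ k ∈ Finset.range T, b k) / (1 - r) ^ 2
      = (w₀ + (∑ k ∈ Finset.range T, b k) / (1 - r)) / (1 - r) := by field_simp
  rw [h3, le_div_iff₀ h1]
  linarith

/-- Squared form of the consensus estimate. -/
theorem sum_norm_mix_sub_average_sq_le {η : ℝ} {B : ℕ} {A : ℕ → Matrix (Fin N) (Fin N) ℝ}
    {c r : ℝ} (hA : Network η B A) (hmix : MixesAtRate A c r) (y : ℕ → Fin N → Vec n) (b : ℕ → ℝ)
    (hb : ∀ k, ∑ i, ‖y (k + 1) i - mix (A k) (y k) i‖ ^ 2 ≤ b k) (k : ℕ) :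
    ∑ i, ‖mix (A k) (y k) i - average (y k)‖ ^ 2
      ≤ c ^ 2 * discounted r (∑ i, ‖y 0 i‖ ^ 2) b k := by
  obtain ⟨hc, hr0, hr1, -⟩ := id hmix
  have hb0 : ∀ k, 0 ≤ b k := fun k => (Finset.sum_nonneg fun _ _ => sq_nonneg _).trans (hb k)
  have hw0 : 0 ≤ ∑ i, ‖y 0 i‖ ^ 2 := Finset.sum_nonneg fun _ _ => sq_nonneg _
  set w := discounted r (∑ i, ‖y 0 i‖ ^ 2) b with hw
  have hwn : ∀ k, 0 ≤ w k := discounted_nonneg hr0 hr1 hw0 hb0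
  have h1r : 0 < 1 - r := sub_pos.2 hr1
  have h := norm_disagreement_le hA hmix y (fun k => √(w k)) (by
    rw [PiLp.norm_eq_of_L2]; exact le_rfl) (fun k => by
    have h1 : ‖WithLp.toLp 2 (y (k + 1) - mix (A k) (y k))‖ ≤ √(b k) := by
      rw [PiLp.norm_eq_of_L2]; exact Real.sqrt_le_sqrt (hb k)
    refine (add_le_add_right h1 _).trans ?_
    refine Real.le_sqrt_of_sq_le ?_
    have e1 := Real.sq_sqrt (hwn k)
    have e2 := Real.sq_sqrt (hb0 k)
    have e3 : w (k + 1) = r * w k + b k / (1 - r) := rfl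
    rw [e3, ← e1, ← e2, Real.sqrt_sq (Real.sqrt_nonneg _), Real.sqrt_sq (Real.sqrt_nonneg _),
      ← sub_le_iff_le_add', le_div_iff₀ h1r]
    nlinarith [mul_nonneg hr0.le (sq_nonneg ((1 - r) * √(w k) - √(b k)))]) k 0
  have h2 := pow_le_pow_left₀ (norm_nonneg _) h 2
  rw [PiLp.norm_sq_eq_of_L2] at h2
  simp only [transition, mix_sub_averagingMatrix, pow_zero, mul_one, mul_pow,
    Real.sq_sqrt (hwn k)] at h2
  exact h2

/-! ### Averages -/

theorem average_mem {X : Set (Vec n)} (hX : Convex ℝ X) (hN : 0 < N) {y : Fin N → Vec n}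
    (hy : ∀ i, y i ∈ X) : average y ∈ X := by
  have hN' : (N : ℝ) ≠ 0 := by positivity
  unfold average
  rw [Finset.smul_sum]
  exact hX.sum_mem (fun _ _ => by positivity) (by simp [hN']) fun i _ => hy i

theorem mix_mem {η : ℝ} {B : ℕ} {A : ℕ → Matrix (Fin N) (Fin N) ℝ} (hA : Network η B A)
    (hη : 0 < η) {X : Set (Vec n)} (hX : Convex ℝ X) {y : Fin N → Vec n} (hy : ∀ i, y i ∈ X)
    (k : ℕ) (i : Fin N) : mix (A k) y i ∈ X :=
  hX.sum_mem (fun j _ => hA.nonneg hη k i j) (hA.row_sum k i) fun j _ => hy j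

theorem average_mix {η : ℝ} {B : ℕ} {A : ℕ → Matrix (Fin N) (Fin N) ℝ} (hA : Network η B A)
    (y : Fin N → Vec n) (k : ℕ) : average (mix (A k) y) = average y := by
  unfold average mix
  rw [Finset.sum_comm]
  simp only [← Finset.sum_smul, hA.col_sum, one_smul]

/-- Bias–variance decomposition of the squared distances to a point. -/
theorem sum_norm_sub_sq (hN : 0 < N) (y : Fin N → Vec n) (z : Vec n) :
    ∑ i, ‖z - y i‖ ^ 2 = N * ‖z - average y‖ ^ 2 + ∑ i, ‖y i - average y‖ ^ 2 := by
  have hN' : (N : ℝ) ≠ 0 := by positivity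
  have h0 : ∑ i, (y i - average y) = 0 := by
    rw [Finset.sum_sub_distrib, Finset.sum_const, Finset.card_univ, Fintype.card_fin, average,
      ← Nat.cast_smul_eq_nsmul ℝ, smul_smul, mul_inv_cancel₀ hN', one_smul, sub_self]
  have h1 : ∀ i, ‖z - y i‖ ^ 2 = ‖z - average y‖ ^ 2
      - 2 * inner ℝ (z - average y) (y i - average y) + ‖y i - average y‖ ^ 2 := fun i => by
    rw [← norm_sub_sq_real, sub_sub_sub_cancel_right]
  simp only [h1, Finset.sum_add_distrib, Finset.sum_sub_distrib, ← Finset.mul_sum, ← inner_sum, h0,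
    inner_zero_right, mul_zero, sub_zero, Finset.sum_const, Finset.card_univ, Fintype.card_fin,
    nsmul_eq_mul]

theorem objective_lipschitz (hN : 0 < N) {L : ℝ≥0} {X : Set (Vec n)} {f : Fin N → Vec n → ℝ}
    (hf : ∀ i, LipschitzOnWith L (f i) X) : LipschitzOnWith L (objective f) X := by
  have hN' : (0 : ℝ) < N := by positivity
  refine LipschitzOnWith.of_dist_le_mul fun x hx y hy => ?_
  rw [Real.dist_eq, objective, objective, ← sub_div, abs_div, abs_of_pos hN', div_le_iff₀ hN',
    ← Finset.sum_sub_distrib]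
  refine (Finset.abs_sum_le_sum_abs _ _).trans ?_
  refine (Finset.sum_le_sum fun i _ => (Real.dist_eq _ _).symm.le.trans
    ((hf i).dist_le_mul x hx y hy)).trans (le_of_eq ?_)
  simp [mul_comm]

end

section

/-! ### One step of the method, pointwise -/

section Deterministic

variable {n N : ℕ} {ρ t : ℝ} {L : ℝ≥0} {X : Set (Vec n)} {f : Fin N → Vec n → ℝ}

theorem Problem.proxRegular (P : Problem ρ L X f) (hN : 0 < N) (ht : 0 < t) (hρt : 2 * ρ * t < 1)
    (hne : X.Nonempty) : ProxRegular ρ t X (objective f) where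
  t_pos := ht
  rho_mul_lt := by linarith
  closed := P.closed
  convex := P.convex
  nonempty := hne
  weaklyConvex := WeaklyConvex.objective hN P.weaklyConvex
  bddBelow := P.bddBelow

/-- The envelope at the new average, estimated by testing its infimum with the proximal point of
the old average. -/
theorem ProxRegular.moreauEnvelope_average_le {h : Vec n → ℝ} (H : ProxRegular ρ t X h)
    (hN : 0 < N) {v ξ p : Fin N → Vec n} {a : ℝ} (hp : ∀ i, IsProj X (v i - a • ξ i) (p i)) :
    moreauEnvelope X h t (average p) ≤ moreauEnvelope X h t (average v)
      + (∑ i, ‖v i - average v‖ ^ 2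
          + 2 * (a * ∑ i, inner ℝ (proxPoint X h t (average v) - v i) (ξ i))
          + a ^ 2 * ∑ i, ‖ξ i‖ ^ 2) / (2 * t * N) := by
  have ht := H.t_pos
  have hN' : (0 : ℝ) < N := by positivity
  set z := proxPoint X h t (average v) with hz
  have h1 := H.moreauEnvelope_le (average p) (H.proxPoint_mem (average v))
  rw [← hz] at h1
  have h2 := sum_norm_sub_sq hN p z
  have h3 := sum_norm_sub_sq hN v z
  have h4 : ∀ i, ‖z - p i‖ ^ 2
      ≤ ‖z - v i‖ ^ 2 + 2 * (a * inner ℝ (z - v i) (ξ i)) + a ^ 2 * ‖ξ i‖ ^ 2 := fun i => by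
    have h5 := (hp i).norm_sub_le H.closed H.convex (H.proxPoint_mem (average v))
    rw [← hz, norm_sub_rev] at h5
    have h6 := pow_le_pow_left₀ (norm_nonneg _) h5 2
    have e : v i - a • ξ i - z = -((z - v i) + a • ξ i) := by abel
    rwa [e, norm_neg, norm_add_sq_real, inner_smul_right, norm_smul, mul_pow, Real.norm_eq_abs,
      sq_abs] at h6
  have h5 := Finset.sum_le_sum fun i (_ : i ∈ Finset.univ) => h4 i
  simp only [Finset.sum_add_distrib, ← Finset.mul_sum] at h5
  have h6 : 0 ≤ ∑ i, ‖p i - average p‖ ^ 2 := Finset.sum_nonneg fun _ _ => sq_nonneg _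
  have h7 : N * ‖z - average p‖ ^ 2 ≤ N * ‖z - average v‖ ^ 2 + (∑ i, ‖v i - average v‖ ^ 2
      + 2 * (a * ∑ i, inner ℝ (z - v i) (ξ i)) + a ^ 2 * ∑ i, ‖ξ i‖ ^ 2) := by linarith
  have h8 := div_le_div_of_nonneg_right h7 (show 0 ≤ 2 * t * N by positivity)
  rw [add_div (_ * _)] at h8
  have e1 : ∀ s : ℝ, N * s / (2 * t * N) = s / (2 * t) := fun s => by field_simp
  rw [e1, e1] at h8
  rw [H.moreauEnvelope_eq (average v), ← hz, proxObjective]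
  linarith

/-- Subgradients of the local functions at the mixed points, tested against the proximal point `z`
of the average: weak convexity of each `fᵢ` gives `fᵢ(z) - fᵢ(vᵢ)`, the Lipschitz property replaces
`vᵢ` by the average, and there the objective decreases quadratically along the proximal step. -/
theorem Problem.sum_inner_subgradient_le (P : Problem ρ L X f) (hN : 0 < N)
    (H : ProxRegular ρ t X (objective f)) {v g : Fin N → Vec n} (hv : ∀ i, v i ∈ X)
    (hg : ∀ i, g i ∈ subdifferential (f i) (v i)) :
    ∑ i, inner ℝ (proxPoint X (objective f) t (average v) - v i) (g i)
      ≤ -(N * (1 / t - ρ)) * ‖proxPoint X (objective f) t (average v) - average v‖ ^ 2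
        + L * ∑ i, ‖v i - average v‖ + ρ / 2 * ∑ i, ‖v i - average v‖ ^ 2 := by
  have hN' : (0 : ℝ) < N := by positivity
  have hav := average_mem P.convex hN hv
  set z := proxPoint X (objective f) t (average v) with hz
  have h1 : ∀ i, inner ℝ (z - v i) (g i)
      ≤ f i z - f i (average v) + L * ‖v i - average v‖ + ρ / 2 * ‖z - v i‖ ^ 2 := fun i => by
    have h2 := (P.weaklyConvex i).subgradient_le (hg i) z
    rw [real_inner_comm] at h2
    have h3 := (P.lipschitz i).dist_le_mul _ hav _ (hv i)
    rw [Real.dist_eq, dist_eq_norm, norm_sub_rev] at h3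
    have h4 := le_abs_self (f i (average v) - f i (v i))
    linarith
  have h2 := Finset.sum_le_sum fun i (_ : i ∈ Finset.univ) => h1 i
  simp only [Finset.sum_add_distrib, Finset.sum_sub_distrib, ← Finset.mul_sum,
    sum_norm_sub_sq hN v z] at h2
  have h3 := H.proxPoint_decrease hav
  rw [← hz, objective, objective, ← sub_div, div_le_iff₀ hN'] at h3
  linarith

end Deterministic

/-! ### Integrability -/

theorem stronglyMeasurable_mix {Ω : Type u} {m : MeasurableSpace Ω} {n N : ℕ}
    {y : Fin N → Ω → Vec n} (hy : ∀ i, StronglyMeasurable[m] (y i)) (M : Matrix (Fin N) (Fin N) ℝ)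
    (i : Fin N) : StronglyMeasurable[m] fun ω => mix M (fun j => y j ω) i :=
  Finset.stronglyMeasurable_fun_sum _ fun j _ => (hy j).const_smul (M i j)

theorem stronglyMeasurable_average {Ω : Type u} {m : MeasurableSpace Ω} {n N : ℕ}
    {y : Fin N → Ω → Vec n} (hy : ∀ i, StronglyMeasurable[m] (y i)) :
    StronglyMeasurable[m] fun ω => average fun j => y j ω := by
  have h := Finset.stronglyMeasurable_fun_sum Finset.univ fun j _ => hy j
  exact h.const_smul (N : ℝ)⁻¹

section Probability

variable {Ω : Type u} [mΩ : MeasurableSpace Ω] {μ : Measure Ω} {n : ℕ}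

/-- Against a random vector known at the earlier time, `ξ` may be replaced by its conditional
expectation. -/
theorem integral_inner_condExp [IsProbabilityMeasure μ] {m : MeasurableSpace Ω} (hm : m ≤ mΩ)
    {w ξ : Ω → Vec n} (hw : StronglyMeasurable[m] w) (hw2 : MemLp w 2 μ) (hξ : MemLp ξ 2 μ) :
    Integrable (fun ω => inner ℝ (w ω) (ξ ω)) μ ∧
      Integrable (fun ω => inner ℝ (w ω) (μ[ξ | m] ω)) μ ∧
      ∫ ω, inner ℝ (w ω) (ξ ω) ∂μ = ∫ ω, inner ℝ (w ω) (μ[ξ | m] ω) ∂μ := by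
  have h1 : Integrable (fun ω => inner ℝ (w ω) (ξ ω)) μ :=
    (hw2.norm.integrable_mul hξ.norm).mono' (hw2.1.inner hξ.1)
      (Eventually.of_forall fun ω => norm_inner_le_norm _ _)
  have h2 := condExp_bilin_of_stronglyMeasurable_left (μ := μ) (innerSL ℝ) hw h1
    (hξ.integrable one_le_two)
  refine ⟨h1, (integrable_condExp (m := m) (f := fun ω => inner ℝ (w ω) (ξ ω))).congr h2, ?_⟩
  rw [← integral_condExp hm (f := fun ω => inner ℝ (w ω) (ξ ω))]
  exact integral_congr_ae h2

theorem memLp_mix {N : ℕ} {y : Fin N → Ω → Vec n} (hy : ∀ i, MemLp (y i) 2 μ)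
    (M : Matrix (Fin N) (Fin N) ℝ) (i : Fin N) :
    MemLp (fun ω => mix M (fun j => y j ω) i) 2 μ :=
  memLp_finsetSum _ fun j _ => (hy j).const_smul (M i j)

theorem memLp_average {N : ℕ} {y : Fin N → Ω → Vec n} (hy : ∀ i, MemLp (y i) 2 μ) :
    MemLp (fun ω => average fun j => y j ω) 2 μ := by
  have h := memLp_finsetSum Finset.univ fun j _ => hy j
  exact h.const_smul (N : ℝ)⁻¹

theorem integrable_norm_sq {y : Ω → Vec n} (hy : MemLp y 2 μ) :
    Integrable (fun ω => ‖y ω‖ ^ 2) μ := hy.norm.integrable_sq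

theorem integral_norm_le_sqrt [IsProbabilityMeasure μ] {y : Ω → Vec n} (hy : MemLp y 2 μ) :
    ∫ ω, ‖y ω‖ ∂μ ≤ √(∫ ω, ‖y ω‖ ^ 2 ∂μ) := by
  have h1 := variance_nonneg (fun ω => ‖y ω‖) μ
  rw [variance_eq_sub hy.norm] at h1
  refine Real.le_sqrt_of_sq_le ?_
  simpa using h1

namespace ProxRegular

variable {ρ t : ℝ} {X : Set (Vec n)} {h : Vec n → ℝ}

theorem integrable_moreauEnvelope [IsProbabilityMeasure μ] (H : ProxRegular ρ t X h)
    {y : Ω → Vec n} (hy : MemLp y 2 μ) : Integrable (fun ω => moreauEnvelope X h t (y ω)) μ := by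
  have ht := H.t_pos
  obtain ⟨x₀, hx₀⟩ := H.nonempty
  have h1 : MemLp (fun ω => x₀ - y ω) 2 μ := (memLp_const x₀).sub hy
  have h2 : Integrable (fun ω => |⨅ z : X, h z| + |h x₀| + ‖x₀ - y ω‖ ^ 2 / (2 * t)) μ :=
    (integrable_const _).add ((integrable_norm_sq h1).div_const _)
  refine h2.mono' (H.differentiable.continuous.comp_aestronglyMeasurable hy.1)
    (Eventually.of_forall fun ω => ?_)
  have h3 := H.moreauEnvelope_le (y ω) hx₀
  have h4 := H.iInf_le_moreauEnvelope (y ω)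
  have h5 := neg_abs_le (⨅ z : X, h z)
  have h6 := le_abs_self (h x₀)
  have h7 := abs_nonneg (⨅ z : X, h z)
  have h8 := abs_nonneg (h x₀)
  have h9 : 0 ≤ ‖x₀ - y ω‖ ^ 2 / (2 * t) := by positivity
  rw [Real.norm_eq_abs, abs_le]
  constructor <;> linarith

/-- Proximal steps from points of `X` are bounded by `2tL`. -/
theorem memLp_proxPoint_sub [IsProbabilityMeasure μ] (H : ProxRegular ρ t X h) {L : ℝ≥0}
    (hL : LipschitzOnWith L h X) {y : Ω → Vec n} (hy : AEStronglyMeasurable y μ)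
    (hyX : ∀ ω, y ω ∈ X) : MemLp (fun ω => proxPoint X h t (y ω) - y ω) 2 μ :=
  MemLp.of_bound ((H.continuous_proxPoint.sub continuous_id).comp_aestronglyMeasurable hy)
    (2 * t * L) (Eventually.of_forall fun ω => H.norm_proxPoint_sub_self_le hL (hyX ω))

theorem integrable_norm_gradient_sq [IsProbabilityMeasure μ] (H : ProxRegular ρ t X h) {L : ℝ≥0}
    (hL : LipschitzOnWith L h X) {y : Ω → Vec n} (hy : AEStronglyMeasurable y μ)
    (hyX : ∀ ω, y ω ∈ X) : Integrable (fun ω => ‖gradient (moreauEnvelope X h t) (y ω)‖ ^ 2) μ := by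
  simp only [H.norm_gradient_sq]
  exact (integrable_norm_sq (H.memLp_proxPoint_sub hL hy hyX)).div_const _

end ProxRegular

namespace Run

variable {N : ℕ} {ℱ : Filtration ℕ mΩ} {ρ : ℝ} {L : ℝ≥0} {X : Set (Vec n)}
  {f : Fin N → Vec n → ℝ} {A : ℕ → Matrix (Fin N) (Fin N) ℝ} {α : ℕ → ℝ}
  {ξ x : ℕ → Fin N → Ω → Vec n}

theorem mem (R : Run μ ℱ L X f A α ξ x) (k : ℕ) (i : Fin N) (ω : Ω) : x k i ω ∈ X := by
  cases k with
  | zero => exact R.init_mem i ω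
  | succ k => exact (R.update k i ω).1

theorem adapted (R : Run μ ℱ L X f A α ξ x) (P : Problem ρ L X f) (k : ℕ) (i : Fin N) :
    StronglyMeasurable[ℱ k] (x k i) := by
  induction k generalizing i with
  | zero => exact R.init_meas i
  | succ k ih =>
    have e : x (k + 1) i = fun ω => proxPoint X (fun _ => 0) 1
        (mix (A k) (fun j => x k j ω) i - α k • ξ k i ω) :=
      funext fun ω => (R.update k i ω).eq_proxPoint P.closed P.convex
    rcases isEmpty_or_nonempty Ω with hΩ | ⟨⟨ω₀⟩⟩
    · exact ⟨fun _ => @SimpleFunc.const Ω (Vec n) (ℱ (k + 1)) 0, fun ω => isEmptyElim ω⟩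
    rw [e]
    refine (ProxRegular.zero P.closed P.convex
      ⟨_, R.mem 0 i ω₀⟩).continuous_proxPoint.comp_stronglyMeasurable ?_
    exact ((stronglyMeasurable_mix ih (A k) i).mono (ℱ.mono (Nat.le_succ k))).sub
      ((R.noise_meas k i).const_smul (α k))

/-- Projecting onto `X` a step that starts in `X` moves by at most the length of the step. -/
theorem norm_step_le {η : ℝ} {B : ℕ} (R : Run μ ℱ L X f A α ξ x) (P : Problem ρ L X f)
    (hA : Network η B A) (hη : 0 < η) (k : ℕ) (i : Fin N) (ω : Ω) :
    ‖x (k + 1) i ω - mix (A k) (fun j => x k j ω) i‖ ≤ α k * ‖ξ k i ω‖ := by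
  have h1 := (R.update k i ω).norm_sub_le P.closed P.convex
    (mix_mem hA hη P.convex (fun j => R.mem k j ω) k i)
  rwa [sub_sub_cancel_left, norm_neg, norm_smul, Real.norm_of_nonneg (R.step_pos k).le] at h1

theorem memLp {η : ℝ} {B : ℕ} (R : Run μ ℱ L X f A α ξ x) (P : Problem ρ L X f)
    (hA : Network η B A) (hη : 0 < η) (k : ℕ) (i : Fin N) : MemLp (x k i) 2 μ := by
  induction k generalizing i with
  | zero => exact R.init_sq i
  | succ k ih =>
    have hv := memLp_mix ih (A k) i
    have h1 : AEStronglyMeasurable (x (k + 1) i) μ :=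
      ((R.adapted P (k + 1) i).mono (ℱ.le _)).aestronglyMeasurable
    have h2 : MemLp (fun ω => x (k + 1) i ω - mix (A k) (fun j => x k j ω) i) 2 μ :=
      (R.noise_sq k i).of_le_mul (h1.sub hv.1)
        (Eventually.of_forall fun ω => R.norm_step_le P hA hη k i ω)
    have h3 := h2.add hv
    refine h3.ae_eq (Eventually.of_forall fun ω => ?_)
    simp

end Run

end Probability

end

section

/-! ### The descent inequality in expectation -/

namespace Run

/-- The total squared disagreement `∑ᵢ ‖vᵢ - x̄‖²` of the mixed points at step `k`. -/
def disagreement {Ω : Type u} {n N : ℕ} (A : ℕ → Matrix (Fin N) (Fin N) ℝ)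
    (x : ℕ → Fin N → Ω → Vec n) (k : ℕ) (ω : Ω) : ℝ :=
  ∑ i, ‖mix (A k) (fun j => x k j ω) i - average fun j => x k j ω‖ ^ 2

theorem disagreement_nonneg {Ω : Type u} {n N : ℕ} (A : ℕ → Matrix (Fin N) (Fin N) ℝ)
    (x : ℕ → Fin N → Ω → Vec n) (k : ℕ) (ω : Ω) : 0 ≤ disagreement A x k ω :=
  Finset.sum_nonneg fun _ _ => sq_nonneg _

variable {Ω : Type u} [mΩ : MeasurableSpace Ω] {μ : Measure Ω} {n N : ℕ}
  {ℱ : Filtration ℕ mΩ} {ρ t η : ℝ} {B : ℕ} {L : ℝ≥0} {X : Set (Vec n)}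
  {f : Fin N → Vec n → ℝ} {A : ℕ → Matrix (Fin N) (Fin N) ℝ} {α : ℕ → ℝ}
  {ξ x : ℕ → Fin N → Ω → Vec n}

theorem integrable_disagreement (R : Run μ ℱ L X f A α ξ x) (P : Problem ρ L X f)
    (hA : Network η B A) (hη : 0 < η) (k : ℕ) : Integrable (disagreement A x k) μ :=
  integrable_finsetSum _ fun i _ =>
    integrable_norm_sq ((memLp_mix (R.memLp P hA hη k) (A k) i).sub
      (memLp_average (R.memLp P hA hη k)))

theorem integrable_sum_noise (R : Run μ ℱ L X f A α ξ x) (k : ℕ) :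
    Integrable (fun ω => ∑ i, ‖ξ k i ω‖ ^ 2) μ :=
  integrable_finsetSum _ fun i _ => integrable_norm_sq (R.noise_sq k i)

theorem integral_sum_noise_le (R : Run μ ℱ L X f A α ξ x) (k : ℕ) :
    ∫ ω, ∑ i, ‖ξ k i ω‖ ^ 2 ∂μ ≤ N * (L : ℝ) ^ 2 := by
  rw [integral_finsetSum _ fun i _ => integrable_norm_sq (R.noise_sq k i)]
  refine (Finset.sum_le_sum fun i _ => R.second_moment k i).trans (le_of_eq ?_)
  simp

/-- The stochastic subgradients enter the descent only through their conditional means, so that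
the pointwise subgradient estimate can be integrated. -/
theorem integral_inner_noise_le [IsProbabilityMeasure μ] (R : Run μ ℱ L X f A α ξ x)
    (P : Problem ρ L X f) (hA : Network η B A) (hη : 0 < η) (hN : 0 < N)
    (H : ProxRegular ρ t X (objective f)) (hρt : 2 * ρ * t < 1) (k : ℕ) :
    Integrable (fun ω => ∑ i, inner ℝ (proxPoint X (objective f) t (average fun j => x k j ω)
        - mix (A k) (fun j => x k j ω) i) (ξ k i ω)) μ ∧
    α k * ∫ ω, ∑ i, inner ℝ (proxPoint X (objective f) t (average fun j => x k j ω)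
        - mix (A k) (fun j => x k j ω) i) (ξ k i ω) ∂μ
      ≤ -(α k * N * t / 2) * ∫ ω, ‖gradient (moreauEnvelope X (objective f) t)
            (average fun j => x k j ω)‖ ^ 2 ∂μ
        + (1 + α k * ρ) / 2 * ∫ ω, disagreement A x k ω ∂μ + N * (α k ^ 2 * L ^ 2) / 2 := by
  have ht := H.t_pos
  have hα := R.step_pos k
  have hL := objective_lipschitz hN P.lipschitz
  have hx2 := R.memLp P hA hη k
  have hvX := fun ω i => mix_mem hA hη P.convex (fun j => R.mem k j ω) k i
  have havX : ∀ ω, (average fun j => x k j ω) ∈ X :=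
    fun ω => average_mem P.convex hN fun j => R.mem k j ω
  have hav : StronglyMeasurable[ℱ k] fun ω => average fun j => x k j ω :=
    stronglyMeasurable_average (R.adapted P k)
  set w : Fin N → Ω → Vec n := fun i ω => proxPoint X (objective f) t (average fun j => x k j ω)
    - mix (A k) (fun j => x k j ω) i with hw
  have hwm : ∀ i, StronglyMeasurable[ℱ k] (w i) := fun i =>
    (H.continuous_proxPoint.comp_stronglyMeasurable hav).sub
      (stronglyMeasurable_mix (R.adapted P k) (A k) i)
  have hw2 : ∀ i, MemLp (w i) 2 μ := fun i => by
    have h1 := (H.memLp_proxPoint_sub hL (hav.mono (ℱ.le k)).aestronglyMeasurable havX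
      (μ := μ)).add ((memLp_average hx2).sub (memLp_mix hx2 (A k) i))
    refine h1.ae_eq (Eventually.of_forall fun ω => ?_)
    simp [hw]
  have hcond := fun i => integral_inner_condExp (ℱ.le k) (hwm i) (hw2 i) (R.noise_sq k i)
  refine ⟨integrable_finsetSum _ fun i _ => (hcond i).1, ?_⟩
  rw [integral_finsetSum _ fun i _ => (hcond i).1,
    Finset.sum_congr rfl fun i _ => (hcond i).2.2,
    ← integral_finsetSum _ fun i _ => (hcond i).2.1, ← integral_const_mul]
  have hG := H.integrable_norm_gradient_sq hL
    (hav.mono (ℱ.le k)).aestronglyMeasurable havX (μ := μ)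
  have hS := R.integrable_disagreement P hA hη k
  rw [← integral_const_mul, ← integral_const_mul, ← integral_add (hG.const_mul _) (hS.const_mul _)]
  have hc : N * (α k ^ 2 * (L : ℝ) ^ 2) / 2 = ∫ _ω, N * (α k ^ 2 * (L : ℝ) ^ 2) / 2 ∂μ := by simp
  rw [hc, ← integral_add ((hG.const_mul _).fun_add (hS.const_mul _)) (integrable_const _)]
  refine integral_mono_ae ((integrable_finsetSum _ fun i _ => (hcond i).2.1).const_mul _)
    (((hG.const_mul _).fun_add (hS.const_mul _)).fun_add (integrable_const _)) ?_
  filter_upwards [ae_all_iff.2 (R.unbiased k)] with ω hω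
  have h1 := P.sum_inner_subgradient_le hN H (hvX ω) hω
  rw [average_mix hA] at h1
  have h2 := mul_le_mul_of_nonneg_left h1 hα.le
  have h3 : α k * (L * ∑ i, ‖mix (A k) (fun j => x k j ω) i - average fun j => x k j ω‖)
      ≤ (N * (α k ^ 2 * L ^ 2) + disagreement A x k ω) / 2 := by
    have h4 : ∀ i, α k * L * ‖mix (A k) (fun j => x k j ω) i - average fun j => x k j ω‖
        ≤ (α k ^ 2 * L ^ 2
          + ‖mix (A k) (fun j => x k j ω) i - average fun j => x k j ω‖ ^ 2) / 2 := fun i => by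
      nlinarith [sq_nonneg (α k * L - ‖mix (A k) (fun j => x k j ω) i - average fun j => x k j ω‖)]
    have h5 := Finset.sum_le_sum fun i (_ : i ∈ Finset.univ) => h4 i
    rw [← Finset.mul_sum, ← Finset.sum_div, Finset.sum_add_distrib] at h5
    simp only [Finset.sum_const, Finset.card_univ, Fintype.card_fin, nsmul_eq_mul] at h5
    rw [← mul_assoc]
    exact h5
  change α k * ∑ i, inner ℝ (w i ω) ((μ[ξ k i | ℱ k]) ω) ≤ _
  change α k * ∑ i, inner ℝ (w i ω) ((μ[ξ k i | ℱ k]) ω) ≤ _ at h2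
  refine h2.trans ?_
  rw [H.norm_gradient_sq]
  set D := ‖proxPoint X (objective f) t (average fun j => x k j ω)
    - average fun j => x k j ω‖ ^ 2 with hD
  have hD0 : 0 ≤ D := sq_nonneg _
  have h6 : α k * (-(N * (1 / t - ρ)) * D) ≤ -(α k * N * t / 2) * (D / t ^ 2) := by
    have e : -(α k * N * t / 2) * (D / t ^ 2) = α k * (-(N * (1 / t / 2)) * D) := by
      field_simp
    rw [e]
    have h7 : 1 / t / 2 ≤ 1 / t - ρ := by
      have : ρ ≤ 1 / t / 2 := by
        rw [div_div, le_div_iff₀ (by positivity)]; linarith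
      linarith
    have h8 : N * (1 / t / 2) * D ≤ N * (1 / t - ρ) * D := by gcongr
    have h9 := mul_le_mul_of_nonneg_left h8 hα.le
    linarith
  have e : ∑ i, ‖mix (A k) (fun j => x k j ω) i - average fun j => x k j ω‖ ^ 2
      = disagreement A x k ω := rfl
  rw [e]
  linarith

/-- The descent inequality in expectation. The condition `2ρt < 1` makes the coefficient of the
gradient term negative before rearranging; Young's inequality splits `α L ‖vᵢ - x̄‖`. -/
theorem integral_descent [IsProbabilityMeasure μ] (R : Run μ ℱ L X f A α ξ x)
    (P : Problem ρ L X f) (hA : Network η B A) (hη : 0 < η) (hN : 0 < N)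
    (H : ProxRegular ρ t X (objective f)) (hρt : 2 * ρ * t < 1) (k : ℕ) :
    α k / 2 * ∫ ω, ‖gradient (moreauEnvelope X (objective f) t) (average fun j => x k j ω)‖ ^ 2 ∂μ
      ≤ ∫ ω, moreauEnvelope X (objective f) t (average fun j => x k j ω) ∂μ
        - ∫ ω, moreauEnvelope X (objective f) t (average fun j => x (k + 1) j ω) ∂μ
        + (1 / t + α k * ρ / (2 * t)) * ((∫ ω, disagreement A x k ω ∂μ) / N)
        + α k ^ 2 * L ^ 2 / t := by
  have ht := H.t_pos
  have hN' : (0 : ℝ) < N := by positivity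
  obtain ⟨hI, hI'⟩ := R.integral_inner_noise_le P hA hη hN H hρt k
  have hS := R.integrable_disagreement P hA hη k
  have hφ := fun k => H.integrable_moreauEnvelope (memLp_average (R.memLp P hA hη k))
  have hΞ := R.integrable_sum_noise k
  have h1 : ∫ ω, moreauEnvelope X (objective f) t (average fun j => x (k + 1) j ω) ∂μ
      ≤ ∫ ω, (moreauEnvelope X (objective f) t (average fun j => x k j ω)
        + (disagreement A x k ω
          + 2 * (α k * ∑ i, inner ℝ (proxPoint X (objective f) t (average fun j => x k j ω)
            - mix (A k) (fun j => x k j ω) i) (ξ k i ω))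
          + α k ^ 2 * ∑ i, ‖ξ k i ω‖ ^ 2) / (2 * t * N)) ∂μ := by
    refine integral_mono (hφ (k + 1)) ((hφ k).fun_add (((hS.fun_add ((hI.const_mul _).const_mul _)).fun_add
      (hΞ.const_mul _)).div_const _)) fun ω => ?_
    have := H.moreauEnvelope_average_le hN fun i => R.update k i ω
    rwa [average_mix hA] at this
  rw [integral_add (hφ k) (((hS.fun_add ((hI.const_mul _).const_mul _)).fun_add
      (hΞ.const_mul _)).div_const _), integral_div,
    integral_add (hS.fun_add ((hI.const_mul _).const_mul _)) (hΞ.const_mul _),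
    integral_add hS ((hI.const_mul _).const_mul _), integral_const_mul, integral_const_mul,
    integral_const_mul] at h1
  have h2 := mul_le_mul_of_nonneg_left (R.integral_sum_noise_le k) (sq_nonneg (α k))
  set G := ∫ ω, ‖gradient (moreauEnvelope X (objective f) t) (average fun j => x k j ω)‖ ^ 2 ∂μ
  set S := ∫ ω, disagreement A x k ω ∂μ
  set I := ∫ ω, ∑ i, inner ℝ (proxPoint X (objective f) t (average fun j => x k j ω)
            - mix (A k) (fun j => x k j ω) i) (ξ k i ω) ∂μ
  set Ξ := ∫ ω, ∑ i, ‖ξ k i ω‖ ^ 2 ∂μ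
  have h3 : S + 2 * (α k * I) + α k ^ 2 * Ξ ≤ 2 * S + α k * ρ * S + 2 * N * (α k ^ 2 * L ^ 2)
      - α k * N * t * G := by linarith
  have h4 := div_le_div_of_nonneg_right h3 (show 0 ≤ 2 * t * N by positivity)
  have e : (2 * S + α k * ρ * S + 2 * N * (α k ^ 2 * L ^ 2) - α k * N * t * G) / (2 * t * N)
      = (1 / t + α k * ρ / (2 * t)) * (S / N) + α k ^ 2 * L ^ 2 / t - α k / 2 * G := by
    field_simp
  rw [e] at h4
  linarith

/-- The accumulated disagreement, controlled by the initial points and the squared step sizes. -/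
theorem sum_integral_disagreement_le (R : Run μ ℱ L X f A α ξ x)
    (P : Problem ρ L X f) (hA : Network η B A) (hη : 0 < η) {c r : ℝ}
    (hmix : MixesAtRate A c r) (T : ℕ) :
    ∑ k ∈ Finset.range T, ∫ ω, disagreement A x k ω ∂μ
      ≤ c ^ 2 * ((∫ ω, ∑ i, ‖x 0 i ω‖ ^ 2 ∂μ) / (1 - r)
        + (N * L ^ 2 * ∑ k ∈ Finset.range T, α k ^ 2) / (1 - r) ^ 2) := by
  obtain ⟨hc, hr0, hr1, -⟩ := id hmix
  have h1r := sub_pos.2 hr1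
  have hS := R.integrable_disagreement P hA hη
  have hΞ := R.integrable_sum_noise
  have hX0 : Integrable (fun ω => ∑ i, ‖x 0 i ω‖ ^ 2) μ :=
    integrable_finsetSum _ fun i _ => integrable_norm_sq (R.init_sq i)
  have hΞs : Integrable (fun ω => ∑ k ∈ Finset.range T, α k ^ 2 * ∑ i, ‖ξ k i ω‖ ^ 2) μ :=
    integrable_finsetSum _ fun k _ => (hΞ k).const_mul _
  have hpt : ∀ ω, ∑ k ∈ Finset.range T, disagreement A x k ω
      ≤ c ^ 2 * ((∑ i, ‖x 0 i ω‖ ^ 2) / (1 - r)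
        + (∑ k ∈ Finset.range T, α k ^ 2 * ∑ i, ‖ξ k i ω‖ ^ 2) / (1 - r) ^ 2) := fun ω => by
    have h1 := sum_norm_mix_sub_average_sq_le hA hmix (fun k j => x k j ω)
      (fun k => α k ^ 2 * ∑ i, ‖ξ k i ω‖ ^ 2) fun k => by
        rw [Finset.mul_sum]
        refine Finset.sum_le_sum fun i _ => ?_
        rw [← mul_pow]
        exact pow_le_pow_left₀ (norm_nonneg _) (R.norm_step_le P hA hη k i ω) 2
    refine (Finset.sum_le_sum fun k _ => h1 k).trans ?_
    rw [← Finset.mul_sum]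
    refine mul_le_mul_of_nonneg_left (sum_discounted_le hr0 hr1 ?_ (fun k => ?_) T) (sq_nonneg c)
    · exact Finset.sum_nonneg fun _ _ => sq_nonneg _
    · exact mul_nonneg (sq_nonneg _) (Finset.sum_nonneg fun _ _ => sq_nonneg _)
  rw [← integral_finsetSum _ fun k _ => hS k]
  refine (integral_mono (integrable_finsetSum _ fun k _ => hS k)
    (((hX0.div_const _).fun_add (hΞs.div_const _)).const_mul _) hpt).trans ?_
  rw [integral_const_mul, integral_add (hX0.div_const _) (hΞs.div_const _), integral_div,
    integral_div, integral_finsetSum _ fun k _ => (hΞ k).const_mul _]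
  gcongr
  rw [Finset.mul_sum]
  refine Finset.sum_le_sum fun k _ => ?_
  rw [integral_const_mul, mul_comm _ (α k ^ 2)]
  exact mul_le_mul_of_nonneg_left (R.integral_sum_noise_le k) (sq_nonneg _)

/-- The summed descent inequality: the weighted gradient norms are bounded by a constant of the
run plus a multiple of the squared step sizes, whose factor depends only on `ρ`, `t`, the mixing
constants, `L` and the bound `a` for the step sizes. -/
theorem sum_step_mul_gradient_le [IsProbabilityMeasure μ] (R : Run μ ℱ L X f A α ξ x)
    (P : Problem ρ L X f) (hA : Network η B A) (hη : 0 < η) (hN : 0 < N)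
    (H : ProxRegular ρ t X (objective f)) (hρ : 0 ≤ ρ) (hρt : 2 * ρ * t < 1) {c r a : ℝ}
    (hmix : MixesAtRate A c r) (ha : ∀ k, α k ≤ a) :
    ∃ D : ℝ, ∀ T, ∑ k ∈ Finset.range T, α k *
        ∫ ω, ‖gradient (moreauEnvelope X (objective f) t) (average fun j => x k j ω)‖ ^ 2 ∂μ
      ≤ D + 2 * ((1 / t + a * ρ / (2 * t)) * c ^ 2 + 1 / t)
        * (L ^ 2 / (1 - r) ^ 2 * ∑ k ∈ Finset.range T, α k ^ 2) := by
  have ht := H.t_pos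
  have hN' : (0 : ℝ) < N := by positivity
  obtain ⟨hc, hr0, hr1, -⟩ := id hmix
  have h1r := sub_pos.2 hr1
  have ha0 : 0 < a := (R.step_pos 0).trans_le (ha 0)
  set K := 1 / t + a * ρ / (2 * t) with hK
  have hK0 : 0 < K := by positivity
  set φ : ℕ → ℝ := fun k =>
    ∫ ω, moreauEnvelope X (objective f) t (average fun j => x k j ω) ∂μ with hφ
  set G : ℕ → ℝ := fun k =>
    ∫ ω, ‖gradient (moreauEnvelope X (objective f) t) (average fun j => x k j ω)‖ ^ 2 ∂μ with hG
  set W := ∫ ω, ∑ i, ‖x 0 i ω‖ ^ 2 ∂μ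
  set m := ⨅ z : X, objective f z
  refine ⟨2 * (φ 0 - m + K * (c ^ 2 * (W / (1 - r)) / N)), fun T => ?_⟩
  have hφm : m ≤ φ T := by
    have h1 : ∫ _ω, m ∂μ ≤ φ T :=
      integral_mono (integrable_const m)
        (H.integrable_moreauEnvelope (memLp_average (R.memLp P hA hη T)))
        fun ω => H.iInf_le_moreauEnvelope _
    simpa using h1
  have h1 : ∀ k, α k * G k ≤ 2 * ((φ k - φ (k + 1))
      + K / N * ∫ ω, disagreement A x k ω ∂μ + L ^ 2 / t * α k ^ 2) := fun k => by
    have h2 := R.integral_descent P hA hη hN H hρt k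
    have h3 : 0 ≤ ∫ ω, disagreement A x k ω ∂μ :=
      integral_nonneg fun ω => disagreement_nonneg A x k ω
    have h4 : (1 / t + α k * ρ / (2 * t)) * ((∫ ω, disagreement A x k ω ∂μ) / N)
        ≤ K * ((∫ ω, disagreement A x k ω ∂μ) / N) := by
      rw [hK]; gcongr; exact ha k
    have e1 : K / N * ∫ ω, disagreement A x k ω ∂μ
        = K * ((∫ ω, disagreement A x k ω ∂μ) / N) := by ring
    have e2 : L ^ 2 / t * α k ^ 2 = α k ^ 2 * L ^ 2 / t := by ring
    rw [e1, e2]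
    change α k / 2 * G k ≤ φ k - φ (k + 1) + _ + _ at h2
    linarith
  have h2 := Finset.sum_le_sum fun k (_ : k ∈ Finset.range T) => h1 k
  rw [← Finset.mul_sum, Finset.sum_add_distrib, Finset.sum_add_distrib, Finset.sum_range_sub',
    ← Finset.mul_sum, ← Finset.mul_sum] at h2
  have h3 := mul_le_mul_of_nonneg_left (R.sum_integral_disagreement_le P hA hη hmix T)
    (show 0 ≤ K / N by positivity)
  set Q := ∑ k ∈ Finset.range T, α k ^ 2
  have hQ : 0 ≤ Q := Finset.sum_nonneg fun _ _ => sq_nonneg _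
  have e1 : K / N * (c ^ 2 * (W / (1 - r) + N * L ^ 2 * Q / (1 - r) ^ 2))
      = K * (c ^ 2 * (W / (1 - r)) / N) + K * c ^ 2 * (L ^ 2 / (1 - r) ^ 2 * Q) := by
    field_simp
  -- `(1 - r)⁻² ≥ 1` absorbs the noise term into the disagreement term.
  have h4 : L ^ 2 / t * Q ≤ 1 / t * (L ^ 2 / (1 - r) ^ 2 * Q) := by
    have h5 : (1 - r) ^ 2 ≤ 1 := pow_le_one₀ h1r.le (by linarith)
    have h6 : (L : ℝ) ^ 2 ≤ L ^ 2 / (1 - r) ^ 2 := by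
      rw [le_div_iff₀ (by positivity)]
      exact mul_le_of_le_one_right (sq_nonneg _) h5
    calc L ^ 2 / t * Q = 1 / t * (L ^ 2 * Q) := by ring
      _ ≤ _ := by gcongr
  rw [e1] at h3
  refine h2.trans ?_
  linarith

end Run

end

section

/-! ### Real sequences -/

/-- A sequence bounded below that increases at most by summable amounts converges. -/
theorem exists_tendsto_of_le_add_summable {a δ : ℕ → ℝ} {m : ℝ} (hm : ∀ k, m ≤ a k)
    (hδ : Summable δ) (h : ∀ k, a (k + 1) ≤ a k + δ k) : ∃ l, Tendsto a atTop (𝓝 l) := by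
  set b : ℕ → ℝ := fun k => a k - ∑ j ∈ Finset.range k, δ j with hb
  have hs := hδ.hasSum.tendsto_sum_nat
  have hanti : Antitone b := antitone_nat_of_succ_le fun k => by
    simp only [hb, Finset.sum_range_succ]
    linarith [h k]
  obtain ⟨M, hM⟩ := hs.bddAbove_range
  have hbdd : BddBelow (range b) := ⟨m - M, by
    rintro _ ⟨k, rfl⟩
    have := hM (mem_range_self k)
    simp only [hb]
    linarith [hm k]⟩
  have h1 := (tendsto_atTop_ciInf hanti hbdd).add hs
  exact ⟨_, h1.congr fun k => by simp [hb]⟩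

/-- If a weighted sum with non-summable weights is bounded, the terms have `liminf` at most
zero. -/
theorem frequently_lt_of_sum_mul_le {α G : ℕ → ℝ} {D : ℝ} (hα : ∀ k, 0 ≤ α k)
    (hG : ∀ k, 0 ≤ G k) (hns : ¬ Summable α)
    (h : ∀ T, ∑ k ∈ Finset.range T, α k * G k ≤ D) {ε : ℝ} (hε : 0 < ε) :
    ∃ᶠ k in atTop, G k < ε := by
  intro hcon
  have hs : Summable fun k => α k * G k :=
    summable_of_sum_range_le (fun k => mul_nonneg (hα k) (hG k)) h
  obtain ⟨K, hK⟩ := eventually_atTop.1 hcon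
  refine hns ((summable_nat_add_iff K).1 ?_)
  refine Summable.of_nonneg_of_le (fun k => hα _) (fun k => ?_)
    (((summable_nat_add_iff K).2 hs).mul_right ε⁻¹)
  have h1 : ε ≤ G (k + K) := not_lt.1 (hK _ (Nat.le_add_left _ _))
  rw [mul_assoc]
  refine le_mul_of_one_le_right (hα _) ?_
  rw [← div_eq_mul_inv, one_le_div₀ hε]
  exact h1

theorem le_one_add_tsum_sq {α : ℕ → ℝ} (hα2 : Summable fun k => α k ^ 2) (k : ℕ) :
    α k ≤ 1 + ∑' k, α k ^ 2 := by
  have h1 := hα2.le_tsum k fun j _ => sq_nonneg _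
  nlinarith [sq_nonneg (α k - 1)]

theorem sum_one_div_le_log {T : ℕ} (hT : 3 ≤ T) :
    ∑ k ∈ Finset.range (T + 1), 1 / ((k : ℝ) + 1) ≤ 3 * Real.log T := by
  have h1 := harmonic_le_one_add_log (T + 1)
  have h2 : ((harmonic (T + 1) : ℚ) : ℝ) = ∑ k ∈ Finset.range (T + 1), 1 / ((k : ℝ) + 1) := by
    simp [harmonic]
  rw [h2] at h1
  have hT' : (3 : ℝ) ≤ T := by exact_mod_cast hT
  -- The bound `3 ≤ T` is used through `e ≤ T`, to absorb the constant `1`.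
  have h3 : 1 ≤ Real.log T := by
    rw [Real.le_log_iff_exp_le (by linarith)]
    exact (Real.exp_one_lt_d9.le.trans (by norm_num)).trans hT'
  have h4 : Real.log ((T + 1 : ℕ) : ℝ) ≤ 2 * Real.log T := by
    rw [← Real.log_rpow (by linarith)]
    refine Real.log_le_log (by positivity) ?_
    push_cast
    rw [Real.rpow_two]
    nlinarith
  linarith

theorem sqrt_le_sum_inv_sqrt {T : ℕ} (hT : 1 ≤ T) :
    √(T : ℝ) / 2 ≤ ∑ k ∈ Finset.Icc 1 T, 1 / √((k : ℝ) + 1) := by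
  have hT' : (1 : ℝ) ≤ T := by exact_mod_cast hT
  have hs : 0 < √(T : ℝ) := Real.sqrt_pos.2 (by linarith)
  have h1 : ∀ k ∈ Finset.Icc 1 T, 1 / (2 * √(T : ℝ)) ≤ 1 / √((k : ℝ) + 1) := fun k hk => by
    have hk' : (k : ℝ) ≤ T := by exact_mod_cast (Finset.mem_Icc.1 hk).2
    refine one_div_le_one_div_of_le (Real.sqrt_pos.2 (by positivity)) ?_
    rw [Real.sqrt_le_left (by positivity), mul_pow, Real.sq_sqrt (by linarith)]
    linarith
  refine le_trans (le_of_eq ?_) (Finset.sum_le_sum h1)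
  rw [Finset.sum_const, Nat.card_Icc, nsmul_eq_mul, Nat.add_sub_cancel]
  field_simp
  rw [Real.sq_sqrt (by linarith)]

namespace Run

variable {Ω : Type u} [mΩ : MeasurableSpace Ω] {μ : Measure Ω} {n N : ℕ}
  {ℱ : Filtration ℕ mΩ} {ρ t η : ℝ} {B : ℕ} {L : ℝ≥0} {X : Set (Vec n)}
  {f : Fin N → Vec n → ℝ} {A : ℕ → Matrix (Fin N) (Fin N) ℝ} {α : ℕ → ℝ}
  {ξ x : ℕ → Fin N → Ω → Vec n}

/-- The existence of a run entails that `X` is nonempty. -/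
theorem proxRegular [IsProbabilityMeasure μ] (R : Run μ ℱ L X f A α ξ x) (P : Problem ρ L X f)
    (hN : 0 < N) (ht : 0 < t) (hρt : 2 * ρ * t < 1) : ProxRegular ρ t X (objective f) := by
  obtain ⟨ω₀⟩ : Nonempty Ω := nonempty_of_isProbabilityMeasure μ
  exact P.proxRegular hN ht hρt ⟨_, R.mem 0 ⟨0, hN⟩ ω₀⟩

theorem integral_gradient_nonneg (h : Vec n → ℝ) (y : Ω → Vec n) :
    0 ≤ ∫ ω, ‖gradient h (y ω)‖ ^ 2 ∂μ :=
  integral_nonneg fun _ => sq_nonneg _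

/-! ### Square-summable step sizes -/

theorem summable_integral_disagreement (R : Run μ ℱ L X f A α ξ x)
    (P : Problem ρ L X f) (hA : Network η B A) (hη : 0 < η) {c r : ℝ}
    (hmix : MixesAtRate A c r) (hα2 : Summable fun k => α k ^ 2) :
    Summable fun k => ∫ ω, disagreement A x k ω ∂μ := by
  have h1r : 0 < 1 - r := sub_pos.2 hmix.2.2.1
  refine summable_of_sum_range_le (c := c ^ 2 * ((∫ ω, ∑ i, ‖x 0 i ω‖ ^ 2 ∂μ) / (1 - r)
      + (N * L ^ 2 * ∑' k, α k ^ 2) / (1 - r) ^ 2))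
    (fun k => integral_nonneg fun ω => disagreement_nonneg A x k ω) fun T => (R.sum_integral_disagreement_le P hA hη hmix T).trans ?_
  have h2 := hα2.sum_le_tsum (Finset.range T) fun k _ => sq_nonneg _
  gcongr

theorem frequently_gradient_lt [IsProbabilityMeasure μ] (R : Run μ ℱ L X f A α ξ x)
    (P : Problem ρ L X f) (hA : Network η B A) (hη : 0 < η) (hN : 0 < N)
    (H : ProxRegular ρ t X (objective f)) (hρ : 0 ≤ ρ) (hρt : 2 * ρ * t < 1) {c r : ℝ}
    (hmix : MixesAtRate A c r) (hα : ¬ Summable α) (hα2 : Summable fun k => α k ^ 2) {ε : ℝ}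
    (hε : 0 < ε) :
    ∃ᶠ k in atTop, ∫ ω, ‖gradient (moreauEnvelope X (objective f) t)
      (average fun j => x k j ω)‖ ^ 2 ∂μ < ε := by
  have ht := H.t_pos
  have h1r : 0 < 1 - r := sub_pos.2 hmix.2.2.1
  have ha := le_one_add_tsum_sq hα2
  have ha0 : 0 < 1 + ∑' k, α k ^ 2 := (R.step_pos 0).trans_le (ha 0)
  obtain ⟨D, hD⟩ := R.sum_step_mul_gradient_le P hA hη hN H hρ hρt hmix ha
  refine frequently_lt_of_sum_mul_le
    (D := D + 2 * ((1 / t + (1 + ∑' k, α k ^ 2) * ρ / (2 * t)) * c ^ 2 + 1 / t)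
      * (L ^ 2 / (1 - r) ^ 2 * ∑' k, α k ^ 2)) (fun k => (R.step_pos k).le)
    (fun k => integral_gradient_nonneg _ _) hα (fun T => (hD T).trans ?_) hε
  have h2 := hα2.sum_le_tsum (Finset.range T) fun k _ => sq_nonneg _
  gcongr

theorem exists_tendsto_integral_average [IsProbabilityMeasure μ] (R : Run μ ℱ L X f A α ξ x)
    (P : Problem ρ L X f) (hA : Network η B A) (hη : 0 < η) (hN : 0 < N)
    (H : ProxRegular ρ t X (objective f)) (hρ : 0 ≤ ρ) (hρt : 2 * ρ * t < 1) {c r : ℝ}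
    (hmix : MixesAtRate A c r) (hα2 : Summable fun k => α k ^ 2) :
    ∃ l, Tendsto (fun k => ∫ ω, moreauEnvelope X (objective f) t
      (average fun j => x k j ω) ∂μ) atTop (𝓝 l) := by
  have ht := H.t_pos
  set a := 1 + ∑' k, α k ^ 2
  have ha : ∀ k, α k ≤ a := le_one_add_tsum_sq hα2
  refine exists_tendsto_of_le_add_summable (m := ⨅ z : X, objective f z)
    (δ := fun k => (1 / t + a * ρ / (2 * t)) * ((∫ ω, disagreement A x k ω ∂μ) / N)
      + α k ^ 2 * (L ^ 2 / t)) (fun k => ?_) ?_ fun k => ?_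
  · have h1 := integral_mono (integrable_const (⨅ z : X, objective f z))
      (H.integrable_moreauEnvelope (memLp_average (R.memLp P hA hη k)))
      fun ω => H.iInf_le_moreauEnvelope (average fun j => x k j ω)
    simpa using h1
  · exact (((R.summable_integral_disagreement P hA hη hmix hα2).div_const _).mul_left _).add
      (hα2.mul_right _)
  · have h1 := R.integral_descent P hA hη hN H hρt k
    have h2 := mul_nonneg (half_pos (R.step_pos k)).le (integral_gradient_nonneg (μ := μ)
      (moreauEnvelope X (objective f) t) fun ω => average fun j => x k j ω)
    have h3 : (1 / t + α k * ρ / (2 * t)) * ((∫ ω, disagreement A x k ω ∂μ) / N)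
        ≤ (1 / t + a * ρ / (2 * t)) * ((∫ ω, disagreement A x k ω ∂μ) / N) := by
      have : 0 ≤ ∫ ω, disagreement A x k ω ∂μ :=
        integral_nonneg fun ω => disagreement_nonneg A x k ω
      gcongr
      exact ha k
    have e : α k ^ 2 * (L ^ 2 / t) = α k ^ 2 * L ^ 2 / t := by ring
    rw [e]
    linarith

/-- The agents reach consensus in mean square: each new point is within `‖vᵢ - x̄‖ + α ‖ξᵢ‖` of
the old average, and the new average minimizes the total squared distance to the new points. -/
theorem integral_norm_sub_average_sq_le (R : Run μ ℱ L X f A α ξ x)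
    (P : Problem ρ L X f) (hA : Network η B A) (hη : 0 < η) (hN : 0 < N) (k : ℕ) (i : Fin N) :
    ∫ ω, ‖x (k + 1) i ω - average fun j => x (k + 1) j ω‖ ^ 2 ∂μ
      ≤ 2 * ∫ ω, disagreement A x k ω ∂μ + 2 * (α k ^ 2 * (N * L ^ 2)) := by
  have hS := R.integrable_disagreement P hA hη k
  have hΞ := R.integrable_sum_noise k
  have hpt : ∀ ω, ‖x (k + 1) i ω - average fun j => x (k + 1) j ω‖ ^ 2
      ≤ 2 * disagreement A x k ω + 2 * (α k ^ 2 * ∑ j, ‖ξ k j ω‖ ^ 2) := fun ω => by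
    set z := average fun j => x k j ω with hz
    have h1 : ‖x (k + 1) i ω - average fun j => x (k + 1) j ω‖ ^ 2
        ≤ ∑ j, ‖x (k + 1) j ω - average fun j => x (k + 1) j ω‖ ^ 2 :=
      Finset.single_le_sum
        (f := fun j => ‖x (k + 1) j ω - average fun j => x (k + 1) j ω‖ ^ 2)
        (fun _ _ => sq_nonneg _) (Finset.mem_univ i)
    have h2 := sum_norm_sub_sq hN (fun j => x (k + 1) j ω) z
    have h3 : 0 ≤ N * ‖z - average fun j => x (k + 1) j ω‖ ^ 2 := by positivity
    have h4 : ∀ j, ‖z - x (k + 1) j ω‖ ^ 2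
        ≤ 2 * ‖mix (A k) (fun j => x k j ω) j - z‖ ^ 2 + 2 * (α k ^ 2 * ‖ξ k j ω‖ ^ 2) := by
      intro j
      have h5 := R.norm_step_le P hA hη k j ω
      have h6 := norm_sub_le_norm_sub_add_norm_sub (x (k + 1) j ω)
        (mix (A k) (fun j => x k j ω) j) z
      rw [norm_sub_rev z]
      have h7 : ‖x (k + 1) j ω - z‖
          ≤ α k * ‖ξ k j ω‖ + ‖mix (A k) (fun j => x k j ω) j - z‖ := by linarith
      have h8 := pow_le_pow_left₀ (norm_nonneg _) h7 2
      nlinarith [sq_nonneg (α k * ‖ξ k j ω‖ - ‖mix (A k) (fun j => x k j ω) j - z‖)]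
    have h5 := Finset.sum_le_sum fun j (_ : j ∈ Finset.univ) => h4 j
    simp only [Finset.sum_add_distrib, ← Finset.mul_sum] at h5
    change _ ≤ 2 * disagreement A x k ω + _ at h5
    linarith
  have h1 := integral_mono (integrable_norm_sq ((R.memLp P hA hη (k + 1) i).sub
    (memLp_average (R.memLp P hA hη (k + 1))))) ((hS.const_mul 2).fun_add
      ((hΞ.const_mul (α k ^ 2)).const_mul 2)) hpt
  rw [integral_add (hS.const_mul 2) ((hΞ.const_mul (α k ^ 2)).const_mul 2), integral_const_mul,
    integral_const_mul, integral_const_mul] at h1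
  have h2 := mul_le_mul_of_nonneg_left (R.integral_sum_noise_le k) (sq_nonneg (α k))
  refine h1.trans ?_
  linarith

theorem tendsto_integral_sub_average [IsProbabilityMeasure μ] (R : Run μ ℱ L X f A α ξ x)
    (P : Problem ρ L X f) (hA : Network η B A) (hη : 0 < η) (hN : 0 < N)
    (H : ProxRegular ρ t X (objective f)) {c r : ℝ}
    (hmix : MixesAtRate A c r) (hα2 : Summable fun k => α k ^ 2) (i : Fin N) :
    Tendsto (fun k => ∫ ω, moreauEnvelope X (objective f) t (x k i ω) ∂μ
      - ∫ ω, moreauEnvelope X (objective f) t (average fun j => x k j ω) ∂μ) atTop (𝓝 0) := by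
  have ht := H.t_pos
  have hL := objective_lipschitz hN P.lipschitz
  set E : ℕ → ℝ := fun k => ∫ ω, ‖x k i ω - average fun j => x k j ω‖ ^ 2 ∂μ with hE
  have hE0 : Tendsto E atTop (𝓝 0) := by
    rw [← tendsto_add_atTop_iff_nat 1]
    have h1 := (((R.summable_integral_disagreement P hA hη hmix hα2).mul_left 2).add
      ((hα2.mul_right (N * (L : ℝ) ^ 2)).mul_left 2)).tendsto_atTop_zero
    exact squeeze_zero (fun k => integral_nonneg fun ω => sq_nonneg _)
      (fun k => R.integral_norm_sub_average_sq_le P hA hη hN k i) h1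
  have hlim : Tendsto (fun k => 2 * L * √(E k) + E k / (2 * t)) atTop (𝓝 0) := by
    have h1 := ((hE0.sqrt).const_mul (2 * (L : ℝ))).add (hE0.div_const (2 * t))
    simpa using h1
  refine squeeze_zero_norm (fun k => ?_) hlim
  have hx := R.memLp P hA hη k i
  have hav := memLp_average (R.memLp P hA hη k)
  have hd : MemLp (fun ω => x k i ω - average fun j => x k j ω) 2 μ := hx.sub hav
  have h1 : ‖∫ ω, (moreauEnvelope X (objective f) t (x k i ω)
      - moreauEnvelope X (objective f) t (average fun j => x k j ω)) ∂μ‖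
      ≤ ∫ ω, (2 * L * ‖x k i ω - average fun j => x k j ω‖
        + ‖x k i ω - average fun j => x k j ω‖ ^ 2 / (2 * t)) ∂μ := by
    refine norm_integral_le_of_norm_le (((hd.integrable one_le_two).norm.const_mul _).fun_add
      ((integrable_norm_sq hd).div_const _)) (Eventually.of_forall fun ω => ?_)
    exact H.abs_moreauEnvelope_sub_le hL (R.mem k i ω)
      (average_mem P.convex hN fun j => R.mem k j ω)
  rw [integral_sub (H.integrable_moreauEnvelope hx) (H.integrable_moreauEnvelope hav)] at h1
  refine h1.trans ?_
  rw [integral_add ((hd.integrable one_le_two).norm.const_mul _)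
      ((integrable_norm_sq hd).div_const _), integral_const_mul, integral_div]
  have h2 := integral_norm_le_sqrt hd
  exact add_le_add_left (mul_le_mul_of_nonneg_left h2 (by positivity)) _

/-! ### Step sizes of order `1/√k` -/

/-- If `L = 0` then the objective is constant on `X`, so points of `X` are their own proximal
points. -/
theorem integral_gradient_eq_zero (R : Run μ ℱ 0 X f A α ξ x) (P : Problem ρ 0 X f)
    (hN : 0 < N) (H : ProxRegular ρ t X (objective f)) (k : ℕ) :
    ∫ ω, ‖gradient (moreauEnvelope X (objective f) t) (average fun j => x k j ω)‖ ^ 2 ∂μ = 0 := by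
  have h1 : ∀ ω, ‖gradient (moreauEnvelope X (objective f) t)
      (average fun j => x k j ω)‖ ^ 2 = 0 := fun ω => by
    have h2 := H.norm_proxPoint_sub_self_le (objective_lipschitz hN P.lipschitz)
      (average_mem P.convex hN fun j => R.mem k j ω)
    rw [NNReal.coe_zero, mul_zero] at h2
    rw [H.norm_gradient_sq, le_antisymm h2 (norm_nonneg _)]
    simp
  simp [h1]

theorem iInf_le_integral_init [IsProbabilityMeasure μ] (R : Run μ ℱ L X f A α ξ x) (hN : 0 < N)
    (H : ProxRegular ρ t X (objective f)) :
    ⨅ z : X, objective f z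
      ≤ ∫ ω, (∑ i, moreauEnvelope X (objective f) t (x 0 i ω)) / N ∂μ := by
  have hN' : (0 : ℝ) < N := by positivity
  have h1 := integral_mono (integrable_const (⨅ z : X, objective f z))
    ((integrable_finsetSum Finset.univ fun i _ =>
      H.integrable_moreauEnvelope (R.init_sq i)).div_const (N : ℝ)) fun ω => by
      rw [le_div_iff₀ hN']
      have h2 := Finset.sum_le_sum fun i (_ : i ∈ Finset.univ) =>
        H.iInf_le_moreauEnvelope (x 0 i ω)
      simpa [mul_comm] using h2
  simpa using h1

/-- The rate. Were all the gradients for `1 ≤ k ≤ T` larger than the bound, the summed descent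
inequality would bound a positive multiple of `log T` by a constant of the run. -/
theorem exists_gradient_le [IsProbabilityMeasure μ] (R : Run μ ℱ L X f A α ξ x)
    (P : Problem ρ L X f) (hA : Network η B A) (hη : 0 < η) (hN : 0 < N)
    (H : ProxRegular ρ t X (objective f)) (hρ : 0 ≤ ρ) (hρt : 2 * ρ * t < 1) {c r c₁ c₂ K : ℝ}
    (hmix : MixesAtRate A c r) (hc₁ : 0 < c₁)
    (hα : ∀ k : ℕ, c₁ / √((k : ℝ) + 1) ≤ α k ∧ α k ≤ c₂ / √((k : ℝ) + 1))
    (hK : K = 2 * ((1 / t + |c₂| * ρ / (2 * t)) * c ^ 2 + 1 / t)) :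
    ∃ T₀ : ℕ, ∀ T ≥ T₀, ∃ k ∈ Finset.Icc 1 T,
      ∫ ω, ‖gradient (moreauEnvelope X (objective f) t) (average fun j => x k j ω)‖ ^ 2 ∂μ
        ≤ 2 / c₁ * (3 * K * c₂ ^ 2 + 1)
          * ((∫ ω, (∑ i, moreauEnvelope X (objective f) t (x 0 i ω)) / N ∂μ
              - ⨅ z : X, objective f z) / √(T : ℝ)
            + (L : ℝ) ^ 2 / (1 - r) ^ 2 * (Real.log T / √(T : ℝ))) := by
  have ht := H.t_pos
  have h1r : 0 < 1 - r := sub_pos.2 hmix.2.2.1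
  have hc := hmix.1
  have hK0 : 0 < K := by rw [hK]; positivity
  set Δ := ∫ ω, (∑ i, moreauEnvelope X (objective f) t (x 0 i ω)) / N ∂μ
    - ⨅ z : X, objective f z with hΔ
  have hΔ0 : 0 ≤ Δ := sub_nonneg.2 (R.iInf_le_integral_init hN H)
  rcases eq_zero_or_pos L with rfl | hL
  · refine ⟨1, fun T hT => ⟨1, Finset.mem_Icc.2 ⟨le_rfl, hT⟩, ?_⟩⟩
    rw [R.integral_gradient_eq_zero P hN H]
    have : 0 ≤ Real.log T := Real.log_natCast_nonneg T
    positivity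
  have hL' : (0 : ℝ) < L := hL
  have hc₂ : ∀ k : ℕ, α k ≤ |c₂| := fun k => by
    refine (hα k).2.trans ((div_le_div_of_nonneg_right (le_abs_self c₂)
      (Real.sqrt_nonneg _)).trans (div_le_self (abs_nonneg _) ?_))
    rw [Real.one_le_sqrt]
    linarith [(Nat.cast_nonneg k : (0 : ℝ) ≤ k)]
  obtain ⟨D, hD⟩ := R.sum_step_mul_gradient_le P hA hη hN H hρ hρt hmix hc₂
  rw [← hK] at hD
  set Λ : ℝ := (L : ℝ) ^ 2 / (1 - r) ^ 2 with hΛ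
  have hΛ0 : 0 < Λ := by positivity
  have hlog : ∀ᶠ T : ℕ in atTop, D < Λ * Real.log T :=
    ((Real.tendsto_log_atTop.comp tendsto_natCast_atTop_atTop).const_mul_atTop
      hΛ0).eventually_gt_atTop D
  obtain ⟨T₁, hT₁⟩ := eventually_atTop.1 hlog
  refine ⟨max T₁ 3, fun T hT => ?_⟩
  have hT3 : 3 ≤ T := (le_max_right _ _).trans hT
  have hTD := hT₁ T ((le_max_left _ _).trans hT)
  by_contra! hcon
  have hTpos : (0 : ℝ) < T := by exact_mod_cast (show 0 < T by omega)
  have hsq : 0 < √(T : ℝ) := Real.sqrt_pos.2 hTpos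
  have hlog0 : 0 ≤ Real.log T := Real.log_natCast_nonneg T
  set G : ℕ → ℝ := fun k =>
    ∫ ω, ‖gradient (moreauEnvelope X (objective f) t) (average fun j => x k j ω)‖ ^ 2 ∂μ
  set b := 2 / c₁ * (3 * K * c₂ ^ 2 + 1) * (Δ / √(T : ℝ) + Λ * (Real.log T / √(T : ℝ))) with hb
  have hb0 : 0 ≤ b := by positivity
  have hα2 : ∑ k ∈ Finset.range (T + 1), α k ^ 2 ≤ c₂ ^ 2 * (3 * Real.log T) := by
    refine le_trans ?_ (mul_le_mul_of_nonneg_left (sum_one_div_le_log hT3) (sq_nonneg c₂))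
    rw [Finset.mul_sum]
    refine Finset.sum_le_sum fun k _ => ?_
    have h1 := pow_le_pow_left₀ (R.step_pos k).le (hα k).2 2
    rwa [div_pow, Real.sq_sqrt (by positivity), ← mul_one_div] at h1
  have hlow : c₁ * (√(T : ℝ) / 2) * b ≤ ∑ k ∈ Finset.range (T + 1), α k * G k := by
    have hsub : Finset.Icc 1 T ⊆ Finset.range (T + 1) := fun k hk => by
      rw [Finset.mem_range]; have := (Finset.mem_Icc.1 hk).2; omega
    calc c₁ * (√(T : ℝ) / 2) * b
        ≤ c₁ * (∑ k ∈ Finset.Icc 1 T, 1 / √((k : ℝ) + 1)) * b := by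
          gcongr; exact sqrt_le_sum_inv_sqrt (by omega)
      _ = ∑ k ∈ Finset.Icc 1 T, c₁ / √((k : ℝ) + 1) * b := by
          rw [Finset.mul_sum, Finset.sum_mul]
          simp only [mul_one_div]
      _ ≤ ∑ k ∈ Finset.Icc 1 T, α k * G k := Finset.sum_le_sum fun k hk =>
          mul_le_mul (hα k).1 (hcon k hk).le hb0 (R.step_pos k).le
      _ ≤ _ := Finset.sum_le_sum_of_subset_of_nonneg hsub fun k _ _ =>
          mul_nonneg (R.step_pos k).le (integral_gradient_nonneg _ _)
  have hb' : c₁ * (√(T : ℝ) / 2) * b = (3 * K * c₂ ^ 2 + 1) * (Δ + Λ * Real.log T) := by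
    rw [hb]; field_simp
  have hup : K * (Λ * ∑ k ∈ Finset.range (T + 1), α k ^ 2)
      ≤ K * (Λ * (c₂ ^ 2 * (3 * Real.log T))) := by gcongr
  have h1 := hD (T + 1)
  change ∑ k ∈ Finset.range (T + 1), α k * G k ≤ _ at h1
  rw [hb'] at hlow
  have h2 : 0 ≤ (3 * K * c₂ ^ 2 + 1) * Δ := by positivity
  linarith

end Run

end

end StoDPSM

end

theorem mainTheorem3 :
    -- (0) the mixing constants `c > 0`, `λ ∈ (0, 1)` of the network exist, and can be chosen
    -- from the number of agents, `η` and `B` alone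
    (∀ (N : ℕ) (η : ℝ) (B : ℕ), 0 < N → 0 < η → η < 1 → 1 ≤ B →
      ∃ c r : ℝ, ∀ A : ℕ → Matrix (Fin N) (Fin N) ℝ,
        StoDPSM.Network η B A → StoDPSM.MixesAtRate A c r) ∧
    -- (1) well-posedness, and convergence in expectation for square-summable step sizes
    (∀ (n N : ℕ) (ρ t η : ℝ) (B : ℕ) (L : ℝ≥0) (X : Set (StoDPSM.Vec n))
      (f : Fin N → StoDPSM.Vec n → ℝ) (A : ℕ → Matrix (Fin N) (Fin N) ℝ) (α : ℕ → ℝ)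
      (Ω : Type u) (mΩ : MeasurableSpace Ω) (μ : Measure Ω) (_ : IsProbabilityMeasure μ)
      (ℱ : Filtration ℕ mΩ) (ξ x : ℕ → Fin N → Ω → StoDPSM.Vec n),
      0 < N → 0 ≤ ρ → 0 < t → 2 * ρ * t < 1 → 0 < η → η < 1 → 1 ≤ B →
      StoDPSM.Problem ρ L X f → StoDPSM.Network η B A → StoDPSM.Run μ ℱ L X f A α ξ x →
      Differentiable ℝ (StoDPSM.moreauEnvelope X (StoDPSM.objective f) t) ∧
      (∀ k i, Integrable
        (fun ω => StoDPSM.moreauEnvelope X (StoDPSM.objective f) t (x k i ω)) μ) ∧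
      (∀ k, Integrable
        (fun ω => StoDPSM.moreauEnvelope X (StoDPSM.objective f) t
          (StoDPSM.average fun i => x k i ω)) μ) ∧
      (∀ k, Integrable
        (fun ω => ‖gradient (StoDPSM.moreauEnvelope X (StoDPSM.objective f) t)
          (StoDPSM.average fun i => x k i ω)‖ ^ 2) μ) ∧
      (¬ Summable α → Summable (fun k => α k ^ 2) →
        Tendsto (fun k => α (k + 1) / α k) atTop (𝓝 1) →
        (∃ φbar : ℝ,
          Tendsto (fun k => ∫ ω, StoDPSM.moreauEnvelope X (StoDPSM.objective f) t
            (StoDPSM.average fun i => x k i ω) ∂μ) atTop (𝓝 φbar) ∧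
          ∀ i, Tendsto (fun k => ∫ ω, StoDPSM.moreauEnvelope X (StoDPSM.objective f) t
            (x k i ω) ∂μ) atTop (𝓝 φbar)) ∧
        ∀ ε > 0, ∃ᶠ k in atTop,
          ∫ ω, ‖gradient (StoDPSM.moreauEnvelope X (StoDPSM.objective f) t)
            (StoDPSM.average fun i => x k i ω)‖ ^ 2 ∂μ < ε)) ∧
    -- (2) the rate for step sizes of exact order `1/√k`
    (∀ ρ t c₁ c₂ c : ℝ, 0 ≤ ρ → 0 < t → 2 * ρ * t < 1 → 0 < c₁ → 0 < c →
      ∃ C : ℝ, 0 < C ∧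
      ∀ (n N : ℕ) (η : ℝ) (B : ℕ) (L : ℝ≥0) (X : Set (StoDPSM.Vec n))
        (f : Fin N → StoDPSM.Vec n → ℝ) (A : ℕ → Matrix (Fin N) (Fin N) ℝ) (α : ℕ → ℝ)
        (Ω : Type u) (mΩ : MeasurableSpace Ω) (μ : Measure Ω) (_ : IsProbabilityMeasure μ)
        (ℱ : Filtration ℕ mΩ) (ξ x : ℕ → Fin N → Ω → StoDPSM.Vec n) (r : ℝ),
        0 < N → 0 < η → η < 1 → 1 ≤ B →
        StoDPSM.Problem ρ L X f → StoDPSM.Network η B A → StoDPSM.Run μ ℱ L X f A α ξ x →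
        (∀ k : ℕ, c₁ / √((k : ℝ) + 1) ≤ α k ∧ α k ≤ c₂ / √((k : ℝ) + 1)) →
        StoDPSM.MixesAtRate A c r →
        ∃ T₀ : ℕ, ∀ T ≥ T₀, ∃ k ∈ Finset.Icc 1 T,
          ∫ ω, ‖gradient (StoDPSM.moreauEnvelope X (StoDPSM.objective f) t)
              (StoDPSM.average fun i => x k i ω)‖ ^ 2 ∂μ ≤
            C * ((∫ ω, (∑ i, StoDPSM.moreauEnvelope X (StoDPSM.objective f) t (x 0 i ω)) / N ∂μ
                    - ⨅ z : X, StoDPSM.objective f z) / √(T : ℝ)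
                + (L : ℝ) ^ 2 / (1 - r) ^ 2 * (Real.log T / √(T : ℝ)))) := by
  refine ⟨fun N η B hN hη hη1 _ => StoDPSM.Network.exists_mixesAtRate N η B hN hη hη1, ?_, ?_⟩
  · intro n N ρ t η B L X f A α Ω mΩ μ _ ℱ ξ x hN hρ ht hρt hη hη1 _ P hA R
    have H := R.proxRegular P hN ht hρt
    have hL := StoDPSM.objective_lipschitz hN P.lipschitz
    have hx := fun k => R.memLp P hA hη k
    have hav := fun k => StoDPSM.memLp_average (hx k)
    refine ⟨H.differentiable, fun k i => H.integrable_moreauEnvelope (hx k i),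
      fun k => H.integrable_moreauEnvelope (hav k), fun k =>
        H.integrable_norm_gradient_sq hL (hav k).1 fun ω =>
          StoDPSM.average_mem P.convex hN fun j => R.mem k j ω, fun hα hα2 _ => ?_⟩
    obtain ⟨c, r, hcr⟩ := StoDPSM.Network.exists_mixesAtRate N η B hN hη hη1
    have hmix := hcr A hA
    obtain ⟨l, hl⟩ := R.exists_tendsto_integral_average P hA hη hN H hρ hρt hmix hα2
    refine ⟨⟨l, hl, fun i => ?_⟩, fun ε hε =>
      R.frequently_gradient_lt P hA hη hN H hρ hρt hmix hα hα2 hε⟩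
    simpa using (R.tendsto_integral_sub_average P hA hη hN H hmix hα2 i).add hl
  · intro ρ t c₁ c₂ c hρ ht hρt hc₁ hc
    -- `|c₂|` keeps the constant positive also when no step sizes satisfy the bounds.
    refine ⟨2 / c₁ * (3 * (2 * ((1 / t + |c₂| * ρ / (2 * t)) * c ^ 2 + 1 / t)) * c₂ ^ 2 + 1),
      by positivity, ?_⟩
    intro n N η B L X f A α Ω mΩ μ _ ℱ ξ x r hN hη hη1 _ P hA R hα hmix
    exact R.exists_gradient_le P hA hη hN (R.proxRegular P hN ht hρt) hρ hρt hmix hc₁ hα rfl
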